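/- The fault-prone Hotelling game $\mathrm{FPH}(n,\lambda)$, for an integer $n\ge 1$ and a real $\lambda>0$, is the following. There are $n$ players (servers); player $i$ chooses a location $x_i\in[0,1]$. Faults occur on $[0,1]$ according to a Poisson process of rate $\lambda$. Clients are spread uniformly on $[0,1]$, and each client chooses the closest server from which it is not separated by a fault. Hence, given the locations and the faults, the market of player $i$ is the segment $[L_i,R_i]\ni x_i$ in which $R_i$ is the closest fault to the right of $x_i$ if that fault is not beyond the closest server location strictly to the right of $x_i$ (the right neighbor); if there is no such fault, $R_i$ is the midpoint between $x_i$ and its right neighbor, or $1$ if there is no right neighbor. $L_i$ is defined symmetrically, with $0$ in place of $1$. The payoff of player $i$ at the profile $x=(x_1,\dots,x_n)$ is $u_i(x)=\mathbb E[R_i-L_i]/\gamma_i$, where $\gamma_i$ is the number of players $j$ (including $i$) with $x_j=x_i$. A profile $x\in[0,1]^n$ is a (pure) Nash equilibrium if no player can increase its payoff by moving alone to another point of $[0,1]$. Theorem 3. There are constants $\alpha_0>0$ and $\beta_0$, independent of $n$ and $\lambda$, with the following properties. (i) $(\alpha_0,\beta_0)$ is the only pair $(\alpha,\beta)$ with $0<\alpha<1$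 and $\beta\ge 0$ that satisfies both $e^{-\alpha}(1+\alpha)=e^{-2\beta}(1+\beta)$ and $e^{-\alpha}\left(1+\frac{\alpha}{2}\right)=e^{-\beta}\left(\frac34+\frac{\beta}{2}\right)$. (ii) For all integers $n\ge 3$ and all reals $\lambda>0$, the game $\mathrm{FPH}(n,\lambda)$ has a Nash equilibrium if and only if $$\lambda\ \ge\ \lambda_{\min}(n)=(n+1)\alpha_0-2\ln\left(\frac{1+\alpha_0}{2}\right).$$ (iii) Numerically, $|\alpha_0-0.58813|<5\cdot10^{-6}$ and $\left|\alpha_0-2\ln\left(\frac{1+\alpha_0}{2}\right)-1.04931\right|<5\cdot10^{-6}$, so that $\lambda_{\min}(n)=n\alpha_0+\left(\alpha_0-2\ln\frac{1+\alpha_0}{2}\right)\approx 0.58813\,n+1.04931$. -/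

import Mathlib

open MeasureTheory ProbabilityTheory

noncomputable section

namespace FPH

/-! ### The faults: a Poisson process on the unit interval -/

/-- The number of faults of the finite fault set `F` in the segment `[a, b]`. -/
def faultCount (F : Finset ℝ) (a b : ℝ) : ℕ :=
  (F.filter (fun f => a ≤ f ∧ f ≤ b)).card

/-- The random finite set `F` of faults (on the probability space `(Ω, P)`) is a Poisson process
of rate `lam` on `[0, 1]`: all faults lie in `[0, 1]`, the number of faults in every segment
`[a, b] ⊆ [0, 1]` is a Poisson random variable with parameter `lam * (b - a)`, and the numbers of
faults in pairwise disjoint segments are independent. -/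
structure IsPoissonFaults {Ω : Type*} [MeasurableSpace Ω] (P : Measure Ω)
    (F : Ω → Finset ℝ) (lam : ℝ) : Prop where
  mem_unit : ∀ ω, ∀ f ∈ F ω, 0 ≤ f ∧ f ≤ 1
  measurable_count : ∀ a b : ℝ, 0 ≤ a → a ≤ b → b ≤ 1 →
    Measurable (fun ω => faultCount (F ω) a b)
  count_law : ∀ a b : ℝ, 0 ≤ a → a ≤ b → b ≤ 1 → ∀ k : ℕ,
    P {ω | faultCount (F ω) a b = k} =
      ENNReal.ofReal (Real.exp (-(lam * (b - a))) * (lam * (b - a)) ^ k / (k.factorial : ℝ))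
  indep_count : ∀ (m : ℕ) (a b : Fin m → ℝ), (∀ k, 0 ≤ a k ∧ a k ≤ b k ∧ b k ≤ 1) →
    (Pairwise fun k l => Disjoint (Set.Icc (a k) (b k)) (Set.Icc (a l) (b l))) →
    iIndepFun (fun k ω => faultCount (F ω) (a k) (b k)) P

/-! ### Servers and their markets -/

/-- The locations of the servers strictly to the left of server `i`. -/
def serversLeft {n : ℕ} (x : Fin n → ℝ) (i : Fin n) : Finset ℝ :=
  (Finset.univ.image x).filter (fun y => y < x i)

/-- The locations of the servers strictly to the right of server `i`. -/
def serversRight {n : ℕ} (x : Fin n → ℝ) (i : Fin n) : Finset ℝ :=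
  (Finset.univ.image x).filter (fun y => x i < y)

open Classical in
/-- The location of the left neighbor of server `i`, and `-1` if there is none. -/
def leftNeighbor {n : ℕ} (x : Fin n → ℝ) (i : Fin n) : ℝ :=
  if h : (serversLeft x i).Nonempty then (serversLeft x i).max' h else -1

open Classical in
/-- The location of the right neighbor of server `i`, and `2` if there is none. -/
def rightNeighbor {n : ℕ} (x : Fin n → ℝ) (i : Fin n) : ℝ :=
  if h : (serversRight x i).Nonempty then (serversRight x i).min' h else 2

/-- The faults between server `i` and its left neighbor (or the left end of the line). -/
def leftFaults {n : ℕ} (F : Finset ℝ) (x : Fin n → ℝ) (i : Fin n) : Finset ℝ :=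
  F.filter (fun f => leftNeighbor x i ≤ f ∧ f ≤ x i)

/-- The faults between server `i` and its right neighbor (or the right end of the line). -/
def rightFaults {n : ℕ} (F : Finset ℝ) (x : Fin n → ℝ) (i : Fin n) : Finset ℝ :=
  F.filter (fun f => x i ≤ f ∧ f ≤ rightNeighbor x i)

open Classical in
/-- The left end of the market of server `i` (the segment of the clients whose closest accessible
server is at `x i`): the closest fault on the left if one lies in the region to the left of `i`,
otherwise the end of the line if `i` is left peripheral, and otherwise the midpoint between `i`
and its left neighbor. -/
def marketLeft {n : ℕ} (F : Finset ℝ) (x : Fin n → ℝ) (i : Fin n) : ℝ :=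
  if h : (leftFaults F x i).Nonempty then (leftFaults F x i).max' h
  else if (serversLeft x i).Nonempty then (leftNeighbor x i + x i) / 2
  else 0

open Classical in
/-- The right end of the market of server `i`: the closest fault on the right if one lies in the
region to the right of `i`, otherwise the end of the line if `i` is right peripheral, and
otherwise the midpoint between `i` and its right neighbor. -/
def marketRight {n : ℕ} (F : Finset ℝ) (x : Fin n → ℝ) (i : Fin n) : ℝ :=
  if h : (rightFaults F x i).Nonempty then (rightFaults F x i).min' h
  else if (serversRight x i).Nonempty then (x i + rightNeighbor x i) / 2
  else 1

/-- The size of the market of server `i` when the set of faults is `F`. -/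
def marketSize {n : ℕ} (F : Finset ℝ) (x : Fin n → ℝ) (i : Fin n) : ℝ :=
  marketRight F x i - marketLeft F x i

/-- The number of servers located where server `i` is (including `i` itself). -/
def colocated {n : ℕ} (x : Fin n → ℝ) (i : Fin n) : ℕ :=
  (Finset.univ.filter (fun j => x j = x i)).card

/-! ### The game -/

/-- The payoff of player `i`: the expected size of its market, shared equally among the colocated
players. -/
def payoff {Ω : Type*} [MeasurableSpace Ω] (P : Measure Ω) (F : Ω → Finset ℝ)
    {n : ℕ} (x : Fin n → ℝ) (i : Fin n) : ℝ :=
  (∫ ω, marketSize (F ω) x i ∂P) / (colocated x i : ℝ)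

/-- `x ∈ [0, 1] ^ n` is a (pure) Nash equilibrium of the game whose random fault set is `F`:
no player can increase its payoff by a unilateral move inside `[0, 1]`. -/
def IsNashEquilibrium {Ω : Type*} [MeasurableSpace Ω] (P : Measure Ω) (F : Ω → Finset ℝ)
    {n : ℕ} (x : Fin n → ℝ) : Prop :=
  (∀ i, x i ∈ Set.Icc (0 : ℝ) 1) ∧
    ∀ i, ∀ y ∈ Set.Icc (0 : ℝ) 1, payoff P F (Function.update x i y) i ≤ payoff P F x i

/-- The threshold `(n + 1) * α - 2 * ln ((1 + α) / 2)`. -/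
def threshold (α : ℝ) (n : ℕ) : ℝ :=
  ((n : ℝ) + 1) * α - 2 * Real.log ((1 + α) / 2)

end FPH

end

noncomputable section

namespace FPH

/-! ### Market shares as functions of rescaled gaps -/

/-! Measure lengths in units of `1 / lam`. The distance to the next fault is exponential, so a side
of a market is worth `innerShare a` when a neighbor is at distance `a`, and `endShare a` when the
end of the line is. `innerShare` is increasing and strictly concave, with slope `exp (-a) * (1 + a)
/ 2`.

For `n ≥ 3` servers cannot share a location (`IsShareEquilibrium.injective`). Strict concavity then
forces each inner server to the middle of its gap, so all inner gaps equal some `α`. Stationarity of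
a peripheral server forces its end gap to be `endGap α`. Adding up lengths gives `threshold α n =
lam`, and `threshold` is strictly increasing in `α`, so `lam` determines the profile.

The deviation that decides existence is that of an inner server jumping into an end gap. Its best
point there is at a distance `β` from the old peripheral server, with `exp (-α) * (1 + α) = exp (-2
* β) * (1 + β)`. It earns `2 - 2 * (exp (-β) * (3/4 + β/2))`, against `2 - 2 * (exp (-α) * (1 +
α/2))` for staying. The difference between staying and jumping is strictly increasing in `α` up to
`1` (`advantage_lt`) and nonnegative from `1` on (`advantage_nonneg_of_one_le`), so it is
nonnegative exactly from its zero `α₀` on. Necessity is `threshold_le_of_equilibrium`, sufficiency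
is `isShareEquilibrium_canonicalProfile`. -/

/-- `lam` times the expected one-sided market of a server whose neighbor on that side is at
rescaled distance `a`. -/
def innerShare (a : ℝ) : ℝ := 1 - Real.exp (-a) * (1 + a / 2)

/-- `lam` times the expected one-sided market of a server without neighbor on that side, at
rescaled distance `a` from the end of the line. -/
def endShare (a : ℝ) : ℝ := 1 - Real.exp (-a)

theorem hasDerivAt_exp_neg (a : ℝ) : HasDerivAt (fun a : ℝ => Real.exp (-a)) (-Real.exp (-a)) a := by
  simpa using (hasDerivAt_neg a).exp

theorem hasDerivAt_endShare (a : ℝ) : HasDerivAt endShare (Real.exp (-a)) a := by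
  exact ((hasDerivAt_exp_neg a).const_sub 1).congr_deriv (neg_neg _)

theorem hasDerivAt_innerShare (a : ℝ) :
    HasDerivAt innerShare (Real.exp (-a) * (1 + a) / 2) a := by
  have h2 : HasDerivAt (fun a : ℝ => 1 + a / 2) (1 / 2) a :=
    ((hasDerivAt_id a).div_const 2).const_add 1
  have := ((hasDerivAt_exp_neg a).mul h2).const_sub 1
  refine this.congr_deriv ?_
  ring

/-- This quantity is twice the slope of `innerShare`, so its decrease is the source of concavity. By
`exp (b - a) > 1 + (b - a)` it comes down to `(1 + b - a) * (1 + a) ≥ 1 + b`. -/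
theorem exp_neg_mul_one_add_lt {a b : ℝ} (ha : 0 ≤ a) (hab : a < b) :
    Real.exp (-b) * (1 + b) < Real.exp (-a) * (1 + a) := by
  have h1 : b - a + 1 < Real.exp (b - a) := Real.add_one_lt_exp (by linarith)
  have h2 : Real.exp (-a) = Real.exp (-b) * Real.exp (b - a) := by
    rw [← Real.exp_add]; congr 1; ring
  rw [h2, mul_assoc]
  apply mul_lt_mul_of_pos_left _ (Real.exp_pos _)
  nlinarith

theorem exp_neg_two_mul_mul_one_add_lt {a b : ℝ} (ha : 0 ≤ a) (hab : a < b) :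
    Real.exp (-2 * b) * (1 + b) < Real.exp (-2 * a) * (1 + a) := by
  have h1 : 2 * (b - a) + 1 < Real.exp (2 * (b - a)) := Real.add_one_lt_exp (by linarith)
  have h2 : Real.exp (-2 * a) = Real.exp (-2 * b) * Real.exp (2 * (b - a)) := by
    rw [← Real.exp_add]; congr 1; ring
  rw [h2, mul_assoc]
  apply mul_lt_mul_of_pos_left _ (Real.exp_pos _)
  nlinarith

theorem exp_neg_mul_one_add_le {a : ℝ} (ha : 0 ≤ a) : Real.exp (-a) * (1 + a) ≤ 1 := by
  rcases ha.eq_or_lt with rfl | h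
  · simp
  · simpa using (exp_neg_mul_one_add_lt le_rfl h).le

theorem exp_neg_mul_one_add_lt_one {a : ℝ} (ha : 0 < a) : Real.exp (-a) * (1 + a) < 1 := by
  simpa using exp_neg_mul_one_add_lt le_rfl ha

theorem strictConcaveOn_innerShare : StrictConcaveOn ℝ (Set.Ici 0) innerShare := by
  apply StrictAntiOn.strictConcaveOn_of_deriv (convex_Ici 0)
  · exact fun x _ => (hasDerivAt_innerShare x).continuousAt.continuousWithinAt
  · intro a ha b hb hab
    rw [interior_Ici, Set.mem_Ioi] at ha
    rw [(hasDerivAt_innerShare a).deriv, (hasDerivAt_innerShare b).deriv]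
    linarith [exp_neg_mul_one_add_lt ha.le hab]

theorem strictMonoOn_innerShare : StrictMonoOn innerShare (Set.Ici 0) := by
  apply strictMonoOn_of_deriv_pos (convex_Ici 0)
  · exact fun x _ => (hasDerivAt_innerShare x).continuousAt.continuousWithinAt
  · intro a ha
    rw [interior_Ici, Set.mem_Ioi] at ha
    rw [(hasDerivAt_innerShare a).deriv]
    positivity

@[simp] theorem innerShare_zero : innerShare 0 = 0 := by simp [innerShare]

@[simp] theorem endShare_zero : endShare 0 = 0 := by simp [endShare]

theorem innerShare_le {a b : ℝ} (ha : 0 ≤ a) (hab : a ≤ b) : innerShare a ≤ innerShare b :=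
  strictMonoOn_innerShare.monotoneOn ha (ha.trans hab) hab

theorem innerShare_nonneg {a : ℝ} (ha : 0 ≤ a) : 0 ≤ innerShare a := by
  simpa using innerShare_le le_rfl ha

theorem endShare_nonneg {a : ℝ} (ha : 0 ≤ a) : 0 ≤ endShare a := by
  simp [endShare, ha]

theorem innerShare_add_lt {a b : ℝ} (ha : 0 ≤ a) (hb : 0 ≤ b) (hab : a ≠ b) :
    innerShare a + innerShare b < 2 * innerShare ((a + b) / 2) := by
  have := strictConcaveOn_innerShare.2 (Set.mem_Ici.2 ha) (Set.mem_Ici.2 hb) hab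
    (show (0 : ℝ) < 1 / 2 by norm_num) (show (0 : ℝ) < 1 / 2 by norm_num) (by norm_num)
  simp only [smul_eq_mul] at this
  rw [show (a + b) / 2 = 1 / 2 * a + 1 / 2 * b by ring]
  linarith

theorem innerShare_add_le {a b c : ℝ} (ha : 0 ≤ a) (hb : 0 ≤ b) (hc : a + b ≤ 2 * c) :
    innerShare a + innerShare b ≤ 2 * innerShare c := by
  have h : innerShare a + innerShare b ≤ 2 * innerShare ((a + b) / 2) := by
    by_cases hab : a = b
    · subst hab; rw [add_self_div_two]; linarith
    · exact (innerShare_add_lt ha hb hab).le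
  linarith [innerShare_le (show 0 ≤ (a + b) / 2 by linarith) (show (a + b) / 2 ≤ c by linarith)]

theorem innerShare_le_tangent {s s₀ : ℝ} (hs : 0 ≤ s) (hs₀ : 0 ≤ s₀) :
    innerShare s ≤ innerShare s₀ + Real.exp (-s₀) * (1 + s₀) / 2 * (s - s₀) := by
  have hc := strictConcaveOn_innerShare.concaveOn
  rcases lt_trichotomy s s₀ with h | rfl | h
  · have := hc.le_slope_of_hasDerivAt (Set.mem_Ici.2 hs) (Set.mem_Ici.2 hs₀) h
      (hasDerivAt_innerShare s₀)
    rw [slope_def_field, le_div_iff₀ (by linarith)] at this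
    linarith
  · simp
  · have := hc.slope_le_of_hasDerivAt (Set.mem_Ici.2 hs₀) (Set.mem_Ici.2 hs) h
      (hasDerivAt_innerShare s₀)
    rw [slope_def_field, div_le_iff₀ (by linarith)] at this
    linarith

/-- Concavity of `endShare` on the whole line, from `exp u ≥ 1 + u`; hence no sign condition on `t`.
-/
theorem endShare_le_tangent (t t₀ : ℝ) :
    endShare t ≤ endShare t₀ + Real.exp (-t₀) * (t - t₀) := by
  have h1 := Real.add_one_le_exp (t₀ - t)
  have h2 : Real.exp (-t) = Real.exp (-t₀) * Real.exp (t₀ - t) := by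
    rw [← Real.exp_add]; congr 1; ring
  have := mul_le_mul_of_nonneg_left h1 (Real.exp_pos (-t₀)).le
  simp only [endShare, h2]
  linarith

/-- The marginal shares of a peripheral server on its two sides agree at `(t₀, s₀)`, so `(t₀, s₀)`
is its best position in a gap of given size. -/
theorem endShare_add_innerShare_le {t s t₀ s₀ : ℝ} (hs : 0 ≤ s) (hs₀ : 0 ≤ s₀)
    (hsum : t + s = t₀ + s₀) (hd : Real.exp (-t₀) = Real.exp (-s₀) * (1 + s₀) / 2) :
    endShare t + innerShare s ≤ endShare t₀ + innerShare s₀ := by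
  have h1 := endShare_le_tangent t t₀
  have h2 := innerShare_le_tangent hs hs₀
  rw [← hd] at h2
  have h3 : s - s₀ = -(t - t₀) := by linarith
  rw [h3] at h2
  linarith

/-- A function with positive derivative increases right after the point. -/
theorem exists_gt_of_hasDerivAt_pos {f : ℝ → ℝ} {f' x : ℝ} (h : HasDerivAt f f' x) (hf : 0 < f')
    {ε : ℝ} (hε : 0 < ε) : ∃ y, x < y ∧ y < x + ε ∧ f x < f y := by
  have h1 := (hasDerivAt_iff_tendsto_slope.1 h).eventually (lt_mem_nhds hf)
  have h2 : ∀ᶠ y in nhdsWithin x (Set.Ioi x), 0 < slope f x y :=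
    h1.filter_mono (nhdsWithin_mono _ fun y hy => ne_of_gt hy)
  obtain ⟨y, hy, hy1, hy2⟩ := (h2.and (Ioo_mem_nhdsGT (show x < x + ε by linarith))).exists
  refine ⟨y, hy1, hy2, ?_⟩
  rw [slope_def_field] at hy
  have := (div_pos_iff_of_pos_right (sub_pos.2 hy1)).1 hy
  linarith

theorem exists_gt_of_hasDerivAt_neg {f : ℝ → ℝ} {f' x : ℝ} (h : HasDerivAt f f' x) (hf : f' < 0)
    {ε : ℝ} (hε : 0 < ε) : ∃ y, x - ε < y ∧ y < x ∧ f x < f y := by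
  have h0 : HasDerivAt (fun z => f (-z)) (-f') (-x) := by
    have h' : HasDerivAt f f' (- -x) := by simpa using h
    exact (h'.comp (-x) (hasDerivAt_neg (-x))).congr_deriv (by ring)
  obtain ⟨z, h1, h2, h3⟩ := exists_gt_of_hasDerivAt_pos h0 (neg_pos.2 hf) hε
  exact ⟨-z, by linarith, by linarith, by simpa using h3⟩

/-! ### The constants -/

/-- Intermediate values on `[0, α]`: the right side is `1` at `0`, and at `α` it has fallen below
the left side. This `β` will be the distance from the best intruder in an end gap to the old
peripheral server. -/
theorem exists_beta {α : ℝ} (hα : 0 ≤ α) : ∃ β, 0 ≤ β ∧ β ≤ α ∧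
    Real.exp (-α) * (1 + α) = Real.exp (-2 * β) * (1 + β) := by
  have hc : ContinuousOn (fun β : ℝ => Real.exp (-2 * β) * (1 + β)) (Set.Icc 0 α) := by fun_prop
  have h := intermediate_value_Icc' hα hc
  obtain ⟨β, hβ, h2⟩ := h (show Real.exp (-α) * (1 + α) ∈ _ from
    ⟨by
      apply mul_le_mul_of_nonneg_right (Real.exp_le_exp.2 (by linarith)) (by linarith),
     by simpa using exp_neg_mul_one_add_le hα⟩)
  exact ⟨β, hβ.1, hβ.2, h2.symm⟩

theorem beta_le {α β : ℝ} (hα : 0 ≤ α)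
    (h : Real.exp (-α) * (1 + α) = Real.exp (-2 * β) * (1 + β)) : β ≤ α := by
  by_contra! hlt
  have h1 := exp_neg_two_mul_mul_one_add_lt hα hlt
  have h2 : Real.exp (-2 * α) * (1 + α) ≤ Real.exp (-α) * (1 + α) :=
    mul_le_mul_of_nonneg_right (Real.exp_le_exp.2 (by linarith)) (by linarith)
  linarith

theorem beta_lt_beta {α₁ α₂ β₁ β₂ : ℝ} (hα₁ : 0 ≤ α₁) (hα : α₁ < α₂) (hβ₂ : 0 ≤ β₂)
    (h₁ : Real.exp (-α₁) * (1 + α₁) = Real.exp (-2 * β₁) * (1 + β₁))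
    (h₂ : Real.exp (-α₂) * (1 + α₂) = Real.exp (-2 * β₂) * (1 + β₂)) : β₁ < β₂ := by
  by_contra! hle
  have h3 := exp_neg_mul_one_add_lt hα₁ hα
  rcases hle.eq_or_lt with h | h
  · subst h; linarith
  · have := exp_neg_two_mul_mul_one_add_lt hβ₂ h
    linarith

theorem exp_neg_mul_lt {a b : ℝ} (hab : a < b) (hb : b ≤ 1) :
    Real.exp (-a) * a < Real.exp (-b) * b := by
  have h1 : a - b + 1 < Real.exp (a - b) := Real.add_one_lt_exp (by linarith)
  have h2 : Real.exp (-b) = Real.exp (-a) * Real.exp (a - b) := by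
    rw [← Real.exp_add]; congr 1; ring
  rw [h2, mul_assoc]
  apply mul_lt_mul_of_pos_left _ (Real.exp_pos _)
  by_cases hb0 : 0 < b
  · nlinarith
  · have h3 : Real.exp (a - b) ≤ 1 := Real.exp_le_one_iff.2 (by linarith)
    nlinarith

/-- The derivative is `(1 + 2β) * exp (-β) * (exp (-β) - 1/4)`, nonnegative on `[0, 1]` because `exp
(-1) ≥ 1/4`. -/
theorem monotoneOn_share_sub : MonotoneOn (fun β : ℝ => Real.exp (-β) * (3 / 4 + β / 2) -
    Real.exp (-2 * β) * (1 + β)) (Set.Icc 0 1) := by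
  have hd : ∀ β : ℝ, HasDerivAt (fun β : ℝ => Real.exp (-β) * (3 / 4 + β / 2) -
      Real.exp (-2 * β) * (1 + β))
      ((1 + 2 * β) * Real.exp (-β) * (Real.exp (-β) - 1 / 4)) β := by
    intro β
    have h1 : HasDerivAt (fun β : ℝ => (3 / 4 + β / 2 : ℝ)) (1 / 2) β :=
      ((hasDerivAt_id β).div_const 2).const_add _
    have h2 : HasDerivAt (fun β : ℝ => (1 + β : ℝ)) 1 β := (hasDerivAt_id β).const_add _
    have h3 : HasDerivAt (fun β : ℝ => Real.exp (-2 * β)) (Real.exp (-2 * β) * (-2)) β := by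
      simpa using ((hasDerivAt_id β).const_mul (-2)).exp
    refine (((hasDerivAt_exp_neg β).mul h1).sub (h3.mul h2)).congr_deriv ?_
    have h4 : Real.exp (-2 * β) = Real.exp (-β) * Real.exp (-β) := by
      rw [← Real.exp_add]; congr 1; ring
    rw [h4]; ring
  apply monotoneOn_of_deriv_nonneg (convex_Icc 0 1)
  · exact fun x _ => (hd x).continuousAt.continuousWithinAt
  · exact fun x _ => (hd x).differentiableAt.differentiableWithinAt
  · intro x hx
    rw [interior_Icc] at hx
    rw [(hd x).deriv]
    have h1 : Real.exp (-1) ≤ Real.exp (-x) := Real.exp_le_exp.2 (by linarith [hx.2])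
    have h2 : (1 / 4 : ℝ) ≤ Real.exp (-1) := by
      rw [Real.exp_neg, one_div]
      exact inv_anti₀ (Real.exp_pos _) (by linarith [Real.exp_one_lt_d9])
    have := Real.exp_pos (-x)
    have h5 : 0 < 1 + 2 * x := by linarith [hx.1]
    exact mul_nonneg (by positivity) (by linarith)

/-- Up to `α = 1`, the advantage of the position `α` over the best deviation into the peripheral
gap is strictly increasing in `α`. -/
theorem advantage_lt {α₁ α₂ β₁ β₂ : ℝ} (hα₁ : 0 ≤ α₁) (hα : α₁ < α₂) (hα₂ : α₂ ≤ 1)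
    (hβ₁ : 0 ≤ β₁) (hβ₂ : 0 ≤ β₂)
    (h₁ : Real.exp (-α₁) * (1 + α₁) = Real.exp (-2 * β₁) * (1 + β₁))
    (h₂ : Real.exp (-α₂) * (1 + α₂) = Real.exp (-2 * β₂) * (1 + β₂)) :
    Real.exp (-β₁) * (3 / 4 + β₁ / 2) - Real.exp (-α₁) * (1 + α₁ / 2) <
    Real.exp (-β₂) * (3 / 4 + β₂ / 2) - Real.exp (-α₂) * (1 + α₂ / 2) := by
  -- Since `exp (-α) * (1 + α) = exp (-2 * β) * (1 + β)`, the advantage equals the function of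
  -- `monotoneOn_share_sub` at `β` plus `α * exp (-α) / 2`. Both terms grow with `α` as long as `α ≤
  -- 1`.
  have hβ := beta_lt_beta hα₁ hα hβ₂ h₁ h₂
  have hb1 := beta_le (hα₁.trans hα.le) h₂
  have h3 := monotoneOn_share_sub ⟨hβ₁, by linarith⟩ ⟨hβ₂, by linarith⟩ hβ.le
  have h4 := exp_neg_mul_lt hα hα₂
  simp only at h3
  linarith

/-- Eliminating `exp (-α)` leaves `(1 + β) * (1 + α/2) / (1 + α) ≤ exp β * (3/4 + β/2)`. Here `exp β
≥ 1 + β`, and `(1 + α/2) / (1 + α) ≤ 3/4` holds exactly from `α = 1` on. -/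
theorem advantage_nonneg_of_one_le {α β : ℝ} (hα : 1 ≤ α) (hβ : 0 ≤ β)
    (h : Real.exp (-α) * (1 + α) = Real.exp (-2 * β) * (1 + β)) :
    Real.exp (-α) * (1 + α / 2) ≤ Real.exp (-β) * (3 / 4 + β / 2) := by
  have h1 : Real.exp (-α) = Real.exp (-2 * β) * (1 + β) / (1 + α) := by
    rw [eq_div_iff (by linarith)]; exact h
  have h2 : Real.exp (-β) = Real.exp (-2 * β) * Real.exp β := by
    rw [← Real.exp_add]; congr 1; ring
  have h3 := Real.add_one_le_exp β
  rw [h1, h2, div_mul_eq_mul_div, div_le_iff₀ (by linarith)]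
  have h4 : (1 + β) * (1 + α / 2) ≤ Real.exp β * (3 / 4 + β / 2) * (1 + α) := by
    have h5 : (1 + β) * ((3 / 4 + β / 2) * (1 + α)) ≤ Real.exp β * ((3 / 4 + β / 2) * (1 + α)) :=
      mul_le_mul_of_nonneg_right (by linarith) (by positivity)
    have h6 : 1 + α / 2 ≤ (3 / 4 + β / 2) * (1 + α) := by nlinarith
    nlinarith [mul_le_mul_of_nonneg_left h6 (show 0 ≤ 1 + β by linarith)]
  have := mul_le_mul_of_nonneg_left h4 (Real.exp_pos (-2 * β)).le
  linarith

/-! ### Numerical enclosure of the constants -/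

theorem exp_neg_bounds {x : ℝ} (h0 : 0 ≤ x) (h1 : x ≤ 1) :
    (∑ m ∈ Finset.range 12, (-x) ^ m / (m.factorial : ℝ)) - 1 / 10 ^ 8 ≤ Real.exp (-x) ∧
    Real.exp (-x) ≤ (∑ m ∈ Finset.range 12, (-x) ^ m / (m.factorial : ℝ)) + 1 / 10 ^ 8 := by
  have h := Real.exp_bound (x := -x) (by rw [abs_neg, abs_of_nonneg h0]; exact h1)
    (n := 12) (by norm_num)
  have h2 : |(-x)| ^ 12 * ((Nat.succ 12 : ℕ) / ((Nat.factorial 12 : ℕ) * (12 : ℕ)) : ℝ)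
      ≤ 1 / 10 ^ 8 := by
    rw [abs_neg, abs_of_nonneg h0]
    have h3 : x ^ 12 ≤ 1 := pow_le_one₀ h0 h1
    have h4 : ((Nat.succ 12 : ℕ) / ((Nat.factorial 12 : ℕ) * (12 : ℕ)) : ℝ) ≤ 1 / 10 ^ 8 := by
      norm_num [Nat.factorial]
    calc _ ≤ 1 * ((Nat.succ 12 : ℕ) / ((Nat.factorial 12 : ℕ) * (12 : ℕ)) : ℝ) :=
          mul_le_mul_of_nonneg_right h3 (by positivity)
      _ ≤ _ := by rw [one_mul]; exact h4
  have h3 := abs_le.1 (h.trans h2)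
  constructor <;> linarith [h3.1, h3.2]

theorem antitone_peripheral_share {β₁ β₂ : ℝ} (h0 : 0 ≤ β₁) (h : β₁ ≤ β₂) :
    Real.exp (-β₂) * (3 / 4 + β₂ / 2) ≤ Real.exp (-β₁) * (3 / 4 + β₁ / 2) := by
  have h1 : β₂ - β₁ + 1 ≤ Real.exp (β₂ - β₁) := Real.add_one_le_exp _
  have h2 : Real.exp (-β₁) = Real.exp (-β₂) * Real.exp (β₂ - β₁) := by
    rw [← Real.exp_add]; congr 1; ring
  rw [h2, mul_assoc]
  apply mul_le_mul_of_nonneg_left _ (Real.exp_pos _).le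
  nlinarith

/-- `β` is known only implicitly. Comparing the decreasing `exp (-2 * β) * (1 + β)` at `0.119004`
with the left side certifies `0.119004 ≤ β`, and a lower bound on `β` is enough because `exp (-β) *
(3/4 + β/2)` is decreasing. `advantage_pos_at` uses the upper bound `0.119011` in the same way. -/
theorem advantage_neg_at {β : ℝ}
    (hβ : 0 ≤ β)
    (h : Real.exp (-0.588125) * (1 + 0.588125) = Real.exp (-2 * β) * (1 + β)) :
    Real.exp (-β) * (3 / 4 + β / 2) < Real.exp (-0.588125) * (1 + 0.588125 / 2) := by
  have e1 := exp_neg_bounds (x := 0.588125) (by norm_num) (by norm_num)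
  have e2 := exp_neg_bounds (x := 0.238008) (by norm_num) (by norm_num)
  have e3 := exp_neg_bounds (x := 0.119004) (by norm_num) (by norm_num)
  norm_num [Finset.sum_range_succ, Nat.factorial] at e1 e2 e3
  have hb : 0.119004 ≤ β := by
    by_contra! hlt
    have := exp_neg_two_mul_mul_one_add_lt hβ hlt
    norm_num at this h
    linarith
  refine (antitone_peripheral_share (by norm_num) hb).trans_lt ?_
  norm_num
  linarith

theorem advantage_pos_at {β : ℝ}
    (h : Real.exp (-0.588135) * (1 + 0.588135) = Real.exp (-2 * β) * (1 + β)) (hβ : 0 ≤ β) :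
    Real.exp (-0.588135) * (1 + 0.588135 / 2) < Real.exp (-β) * (3 / 4 + β / 2) := by
  have e1 := exp_neg_bounds (x := 0.588135) (by norm_num) (by norm_num)
  have e2 := exp_neg_bounds (x := 0.238022) (by norm_num) (by norm_num)
  have e3 := exp_neg_bounds (x := 0.119011) (by norm_num) (by norm_num)
  norm_num [Finset.sum_range_succ, Nat.factorial] at e1 e2 e3
  have hb : β ≤ 0.119011 := by
    by_contra! hlt
    have := exp_neg_two_mul_mul_one_add_lt (by norm_num) hlt
    norm_num at this h
    linarith
  refine lt_of_lt_of_le ?_ (antitone_peripheral_share hβ hb)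
  norm_num
  linarith

/-- The map `β ↦ exp (-2 * β) * (1 + β)` is continuous and injective on a compact interval, hence an
embedding, so the implicit `β` depends continuously on `α`. The advantage is then continuous in `α`
and changes sign between `0.588125` and `0.588135`. -/
theorem exists_alpha_beta : ∃ α β : ℝ, 0.588125 < α ∧ α < 0.588135 ∧ 0 ≤ β ∧
    Real.exp (-α) * (1 + α) = Real.exp (-2 * β) * (1 + β) ∧
    Real.exp (-α) * (1 + α / 2) = Real.exp (-β) * (3 / 4 + β / 2) := by
  let I : Set ℝ := Set.Icc 0.588125 0.588135
  let f : Set.Icc (0 : ℝ) 1 → ℝ := fun β => Real.exp (-2 * β) * (1 + β)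
  have hf : Continuous f := by fun_prop
  have hinj : Function.Injective f := by
    intro a b hab
    by_contra hne
    rcases lt_or_gt_of_ne hne with h | h
    · exact absurd hab (exp_neg_two_mul_mul_one_add_lt a.2.1 h).ne'
    · exact absurd hab (exp_neg_two_mul_mul_one_add_lt b.2.1 h).ne
  have hex : ∀ a : I, ∃ b : Set.Icc (0 : ℝ) 1, f b = Real.exp (-a) * (1 + a) := by
    intro a
    have ha1 : (0.588125 : ℝ) ≤ a := a.2.1
    have ha2 : (a : ℝ) ≤ 0.588135 := a.2.2
    obtain ⟨β, h1, h2, h3⟩ := exists_beta (α := a) (by linarith)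
    exact ⟨⟨β, h1, by linarith⟩, h3.symm⟩
  choose g hg using hex
  have hgc : Continuous g := by
    rw [(hf.isClosedEmbedding hinj).isEmbedding.continuous_iff]
    have : f ∘ g = fun a : I => Real.exp (-a) * (1 + a) := funext hg
    rw [this]; fun_prop
  have hI : PreconnectedSpace I := Subtype.preconnectedSpace isPreconnected_Icc
  let D : I → ℝ := fun a =>
    Real.exp (-(g a : ℝ)) * (3 / 4 + g a / 2) - Real.exp (-a) * (1 + a / 2)
  have hD : Continuous D := by fun_prop
  have hlo : D ⟨0.588125, by norm_num [I]⟩ < 0 :=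
    sub_neg.2 (advantage_neg_at (g _).2.1 (hg ⟨0.588125, by norm_num [I]⟩).symm)
  have hhi : 0 < D ⟨0.588135, by norm_num [I]⟩ :=
    sub_pos.2 (advantage_pos_at (hg ⟨0.588135, by norm_num [I]⟩).symm (g _).2.1)
  obtain ⟨a, ha⟩ := mem_range_of_exists_le_of_exists_ge hD ⟨_, hlo.le⟩ ⟨_, hhi.le⟩
  refine ⟨a, g a, lt_of_le_of_ne a.2.1 ?_, lt_of_le_of_ne a.2.2 ?_, (g a).2.1, (hg a).symm,
    (sub_eq_zero.1 ha).symm⟩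
  · intro h
    have : a = ⟨0.588125, by norm_num [I]⟩ := Subtype.ext h.symm
    rw [← this, ha] at hlo
    exact lt_irrefl _ hlo
  · intro h
    have : a = ⟨0.588135, by norm_num [I]⟩ := Subtype.ext h
    rw [← this, ha] at hhi
    exact lt_irrefl _ hhi

theorem log_constant_bounds {α : ℝ} (h1 : 0.588125 < α) (h2 : α < 0.588135) :
    |(α - 2 * Real.log ((1 + α) / 2)) - 1.04931| < 5 / 10 ^ 6 := by
  have e1 := exp_neg_bounds (x := 0.230594) (by norm_num) (by norm_num)
  have e2 := exp_neg_bounds (x := 0.230592) (by norm_num) (by norm_num)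
  norm_num [Finset.sum_range_succ, Nat.factorial] at e1 e2
  have l1 : -0.230594 < Real.log ((1 + 0.588125) / 2) := by
    rw [Real.lt_log_iff_exp_lt (by norm_num)]
    norm_num; linarith
  have l2 : Real.log ((1 + 0.588125) / 2) < -0.230592 := by
    rw [Real.log_lt_iff_lt_exp (by norm_num)]
    norm_num; linarith
  have hy : Real.log ((1 + α) / (1 + 0.588125)) =
      Real.log ((1 + α) / 2) - Real.log ((1 + 0.588125) / 2) := by
    rw [← Real.log_div (by linarith) (by norm_num)]
    congr 1; field_simp
  have l3 := Real.log_le_sub_one_of_pos (show 0 < (1 + α) / (1 + 0.588125) by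
    apply div_pos <;> linarith)
  have l4 := Real.one_sub_inv_le_log_of_pos (show 0 < (1 + α) / (1 + 0.588125) by
    apply div_pos <;> linarith)
  rw [hy] at l3 l4
  -- `1.59` is a rational upper bound for `1 + α`; it makes the lower bound on the logarithm linear
  -- in `α`.
  have l5 : (α - 0.588125) / 1.59 ≤ 1 - ((1 + α) / (1 + 0.588125))⁻¹ := by
    rw [inv_div, one_sub_div (by linarith), div_le_div_iff₀ (by norm_num) (by linarith)]
    nlinarith
  rw [abs_lt]
  constructor <;> norm_num at * <;> linarith

/-! ### Expected markets -/

theorem faultCount_eq_zero_iff {F : Finset ℝ} {a b : ℝ} :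
    faultCount F a b = 0 ↔ ∀ f ∈ F, a ≤ f → b < f := by
  simp [faultCount, Finset.filter_eq_empty_iff]

theorem IsPoissonFaults.measurableSet_faultCount_eq_zero {Ω : Type*} [MeasurableSpace Ω]
    {P : Measure Ω} {F : Ω → Finset ℝ} {lam : ℝ} (hF : IsPoissonFaults P F lam) {a b : ℝ}
    (ha : 0 ≤ a) (hab : a ≤ b) (hb : b ≤ 1) : MeasurableSet {ω | faultCount (F ω) a b = 0} :=
  hF.measurable_count a b ha hab hb (measurableSet_singleton 0)

theorem IsPoissonFaults.prob_faultCount_eq_zero {Ω : Type*} [MeasurableSpace Ω]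
    {P : Measure Ω} {F : Ω → Finset ℝ} {lam : ℝ} (hF : IsPoissonFaults P F lam) {a b : ℝ}
    (ha : 0 ≤ a) (hab : a ≤ b) (hb : b ≤ 1) :
    P.real {ω | faultCount (F ω) a b = 0} = Real.exp (-(lam * (b - a))) := by
  rw [measureReal_def, hF.count_law a b ha hab hb 0]
  simp [ENNReal.toReal_ofReal, (Real.exp_pos _).le]

/-- An exponential random variable truncated at `d`. -/
theorem integral_truncated_exponential {Ω : Type*} [MeasurableSpace Ω] {P : Measure Ω}
    [IsProbabilityMeasure P] {lam d : ℝ} (hlam : 0 < lam) {T : Ω → ℝ} (h0 : ∀ ω, 0 ≤ T ω)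
    (hd : ∀ ω, T ω ≤ d) (hm : ∀ t, 0 ≤ t → t < d → MeasurableSet {ω | t < T ω})
    (hP : ∀ t, 0 ≤ t → t < d → P.real {ω | t < T ω} = Real.exp (-(lam * t))) :
    Integrable T P ∧ ∫ ω, T ω ∂P = (1 - Real.exp (-(lam * d))) / lam := by
  have hd0 : 0 ≤ d := by
    obtain ⟨ω⟩ := nonempty_of_isProbabilityMeasure P
    exact (h0 ω).trans (hd ω)
  have hmeas : Measurable T := by
    refine measurable_of_Ioi fun t => ?_
    change MeasurableSet {ω | t < T ω}
    by_cases ht : 0 ≤ t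
    · by_cases htd : t < d
      · exact hm t ht htd
      · convert MeasurableSet.empty
        ext ω
        simpa using (hd ω).trans (not_lt.1 htd)
    · convert MeasurableSet.univ
      ext ω
      simpa using (not_le.1 ht).trans_le (h0 ω)
  have hint : Integrable T P := by
    refine Integrable.of_bound hmeas.aestronglyMeasurable d (Filter.Eventually.of_forall fun ω => ?_)
    rw [Real.norm_eq_abs, abs_of_nonneg (h0 ω)]
    exact hd ω
  refine ⟨hint, ?_⟩
  -- Layer-cake formula: the mean of `T` is the integral of its tail, which is `exp (-(lam * t))`
  -- below `d` and zero from `d` on.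
  rw [hint.integral_eq_integral_meas_lt (Filter.Eventually.of_forall h0)]
  have h1 : ∫ t in Set.Ioi 0, P.real {ω | t < T ω} =
      ∫ t in Set.Ioi 0, (Set.Iio d).indicator (fun t => Real.exp (-(lam * t))) t := by
    refine setIntegral_congr_fun measurableSet_Ioi fun t ht => ?_
    by_cases htd : t < d
    · simpa [Set.indicator, htd] using hP t (le_of_lt ht) htd
    · have : {ω | t < T ω} = ∅ := by
        ext ω
        simpa using (hd ω).trans (not_lt.1 htd)
      simp [Set.indicator, htd, this]
  rw [h1, setIntegral_indicator measurableSet_Iio, Set.Ioi_inter_Iio,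
    ← integral_Ioc_eq_integral_Ioo, ← intervalIntegral.integral_of_le hd0]
  have hderiv : ∀ t ∈ Set.uIcc 0 d, HasDerivAt (fun t => -Real.exp (-(lam * t)) / lam)
      (Real.exp (-(lam * t))) t := by
    intro t _
    have := ((((hasDerivAt_id t).const_mul lam).neg).exp.neg).div_const lam
    refine this.congr_deriv ?_
    simp only [id, mul_one, mul_neg, neg_neg]
    rw [mul_div_cancel_right₀ _ hlam.ne']
    simp
  rw [intervalIntegral.integral_eq_sub_of_hasDerivAt hderiv
    (Continuous.intervalIntegrable (by fun_prop) _ _)]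
  simp
  ring

theorem integral_add_ite_mul {Ω : Type*} [MeasurableSpace Ω] {P : Measure Ω}
    [IsProbabilityMeasure P] {T : Ω → ℝ} (hT : Integrable T P) {E : Set Ω}
    (hE : MeasurableSet E) (x c s : ℝ) :
    Integrable (fun ω => x + s * T ω + E.indicator (fun _ => c) ω) P ∧
    ∫ ω, (x + s * T ω + E.indicator (fun _ => c) ω) ∂P = x + s * ∫ ω, T ω ∂P + c * P.real E := by
  have h1 : Integrable (fun ω => x + s * T ω) P := (integrable_const x).add (hT.const_mul s)
  have h2 : Integrable (E.indicator (fun _ : Ω => c)) P := (integrable_const c).indicator hE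
  refine ⟨h1.add h2, ?_⟩
  rw [integral_add h1 h2, integral_add (integrable_const x) (hT.const_mul s),
    integral_const_mul, integral_indicator_const c hE]
  simp [mul_comm]

/-- `R = x + T + c * 1_E`, with `E` the event of no fault in `[x, e]` and `T` the distance to the
first fault, truncated at `e - x`. The event `t < T` says that `[x, x + t]` is free of faults. The
correction `c` is minus half the gap before a neighbor and `0` before the end of the line. -/
theorem integral_first_fault_right {Ω : Type*} [MeasurableSpace Ω] {P : Measure Ω}
    [IsProbabilityMeasure P] {F : Ω → Finset ℝ} {lam : ℝ} (hlam : 0 < lam)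
    (hF : IsPoissonFaults P F lam) {x e : ℝ} (hx : 0 ≤ x) (hxe : x ≤ e) (he : e ≤ 1) (c : ℝ)
    {R : Ω → ℝ} (h₁ : ∀ ω, ∀ h : ((F ω).filter (fun f => x ≤ f ∧ f ≤ e)).Nonempty,
      R ω = ((F ω).filter (fun f => x ≤ f ∧ f ≤ e)).min' h)
    (h₂ : ∀ ω, ¬ ((F ω).filter (fun f => x ≤ f ∧ f ≤ e)).Nonempty → R ω = e + c) :
    Integrable R P ∧ ∫ ω, R ω ∂P =
      x + (1 - Real.exp (-(lam * (e - x)))) / lam + c * Real.exp (-(lam * (e - x))) := by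
  classical
  let E : Set Ω := {ω | faultCount (F ω) x e = 0}
  have hE : MeasurableSet E := hF.measurableSet_faultCount_eq_zero hx hxe he
  have hEiff : ∀ ω, ω ∈ E ↔ ¬ ((F ω).filter (fun f => x ≤ f ∧ f ≤ e)).Nonempty := by
    intro ω
    simp [E, faultCount]
  let T : Ω → ℝ := fun ω => R ω - x - E.indicator (fun _ => c) ω
  have hTE : ∀ ω, ω ∈ E → T ω = e - x := by
    intro ω hω
    simp only [T, Set.indicator_of_mem hω, h₂ ω ((hEiff ω).1 hω)]
    ring
  have hTN : ∀ ω, ω ∉ E → ∃ f ∈ F ω, x ≤ f ∧ f ≤ e ∧ T ω = f - x ∧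
      ∀ g ∈ F ω, x ≤ g → f ≤ g := by
    intro ω hω
    have hne := not_not.1 (mt (hEiff ω).2 hω)
    have hmem := Finset.min'_mem _ hne
    obtain ⟨hm1, hm2, hm3⟩ := Finset.mem_filter.1 hmem
    refine ⟨_, hm1, hm2, hm3, ?_, ?_⟩
    · simp only [T, Set.indicator_of_notMem hω, h₁ ω hne]
      ring
    · intro g hg hxg
      by_cases hge : g ≤ e
      · exact Finset.min'_le _ _ (Finset.mem_filter.2 ⟨hg, hxg, hge⟩)
      · exact hm3.trans (not_le.1 hge).le
  have hset : ∀ t, 0 ≤ t → t < e - x → {ω | t < T ω} = {ω | faultCount (F ω) x (x + t) = 0} := by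
    intro t ht0 ht
    ext ω
    simp only [Set.mem_ofPred_eq, faultCount_eq_zero_iff]
    by_cases hω : ω ∈ E
    · rw [hTE ω hω]
      have : ∀ f ∈ F ω, x ≤ f → e < f := faultCount_eq_zero_iff.1 hω
      exact ⟨fun _ f hf hxf => by linarith [this f hf hxf], fun _ => ht⟩
    · obtain ⟨f, hf, hxf, hfe, hT, hmin⟩ := hTN ω hω
      rw [hT]
      exact ⟨fun h g hg hxg => by linarith [hmin g hg hxg], fun h => by linarith [h f hf hxf]⟩
  obtain ⟨hi, hv⟩ := integral_truncated_exponential (P := P) (T := T) (d := e - x) hlam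
    (fun ω => by
      by_cases hω : ω ∈ E
      · rw [hTE ω hω]; linarith
      · obtain ⟨f, -, hxf, -, hT, -⟩ := hTN ω hω
        rw [hT]; linarith)
    (fun ω => by
      by_cases hω : ω ∈ E
      · rw [hTE ω hω]
      · obtain ⟨f, -, -, hfe, hT, -⟩ := hTN ω hω
        rw [hT]; linarith)
    (fun t h0 h => by
      rw [hset t h0 h]
      exact hF.measurableSet_faultCount_eq_zero hx (by linarith) (by linarith))
    (fun t h0 h => by
      rw [hset t h0 h, hF.prob_faultCount_eq_zero hx (by linarith) (by linarith)]
      simp)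
  have h3 := integral_add_ite_mul hi hE x c 1
  have h4 : (fun ω => x + 1 * T ω + E.indicator (fun _ => c) ω) = R := by
    ext ω; simp only [T]; ring
  rw [h4, hv, hF.prob_faultCount_eq_zero hx hxe he, one_mul] at h3
  exact h3

theorem integral_first_fault_left {Ω : Type*} [MeasurableSpace Ω] {P : Measure Ω}
    [IsProbabilityMeasure P] {F : Ω → Finset ℝ} {lam : ℝ} (hlam : 0 < lam)
    (hF : IsPoissonFaults P F lam) {x e : ℝ} (he : 0 ≤ e) (hxe : e ≤ x) (hx : x ≤ 1) (c : ℝ)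
    {R : Ω → ℝ} (h₁ : ∀ ω, ∀ h : ((F ω).filter (fun f => e ≤ f ∧ f ≤ x)).Nonempty,
      R ω = ((F ω).filter (fun f => e ≤ f ∧ f ≤ x)).max' h)
    (h₂ : ∀ ω, ¬ ((F ω).filter (fun f => e ≤ f ∧ f ≤ x)).Nonempty → R ω = e + c) :
    Integrable R P ∧ ∫ ω, R ω ∂P =
      x - (1 - Real.exp (-(lam * (x - e)))) / lam + c * Real.exp (-(lam * (x - e))) := by
  classical
  let E : Set Ω := {ω | faultCount (F ω) e x = 0}
  have hE : MeasurableSet E := hF.measurableSet_faultCount_eq_zero he hxe hx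
  have hEiff : ∀ ω, ω ∈ E ↔ ¬ ((F ω).filter (fun f => e ≤ f ∧ f ≤ x)).Nonempty := by
    intro ω
    simp [E, faultCount]
  let T : Ω → ℝ := fun ω => x - R ω + E.indicator (fun _ => c) ω
  have hTE : ∀ ω, ω ∈ E → T ω = x - e := by
    intro ω hω
    simp only [T, Set.indicator_of_mem hω, h₂ ω ((hEiff ω).1 hω)]
    ring
  have hTN : ∀ ω, ω ∉ E → ∃ f ∈ F ω, e ≤ f ∧ f ≤ x ∧ T ω = x - f ∧
      ∀ g ∈ F ω, g ≤ x → g ≤ f := by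
    intro ω hω
    have hne := not_not.1 (mt (hEiff ω).2 hω)
    have hmem := Finset.max'_mem _ hne
    obtain ⟨hm1, hm2, hm3⟩ := Finset.mem_filter.1 hmem
    refine ⟨_, hm1, hm2, hm3, ?_, ?_⟩
    · simp only [T, Set.indicator_of_notMem hω, h₁ ω hne]
      ring
    · intro g hg hxg
      by_cases hge : e ≤ g
      · exact Finset.le_max' _ _ (Finset.mem_filter.2 ⟨hg, hge, hxg⟩)
      · exact (not_le.1 hge).le.trans hm2
  have hset : ∀ t, 0 ≤ t → t < x - e → {ω | t < T ω} = {ω | faultCount (F ω) (x - t) x = 0} := by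
    intro t ht0 ht
    ext ω
    simp only [Set.mem_ofPred_eq, faultCount_eq_zero_iff]
    by_cases hω : ω ∈ E
    · rw [hTE ω hω]
      have : ∀ f ∈ F ω, e ≤ f → x < f := faultCount_eq_zero_iff.1 hω
      exact ⟨fun _ f hf hxf => this f hf (by linarith), fun _ => ht⟩
    · obtain ⟨f, hf, hxf, hfe, hT, hmin⟩ := hTN ω hω
      rw [hT]
      constructor
      · intro h g hg hxg
        by_contra! hgx
        linarith [hmin g hg hgx]
      · intro h
        by_contra! hfx
        linarith [h f hf (by linarith)]
  obtain ⟨hi, hv⟩ := integral_truncated_exponential (P := P) (T := T) (d := x - e) hlam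
    (fun ω => by
      by_cases hω : ω ∈ E
      · rw [hTE ω hω]; linarith
      · obtain ⟨f, -, -, hfe, hT, -⟩ := hTN ω hω
        rw [hT]; linarith)
    (fun ω => by
      by_cases hω : ω ∈ E
      · rw [hTE ω hω]
      · obtain ⟨f, -, hxf, -, hT, -⟩ := hTN ω hω
        rw [hT]; linarith)
    (fun t h0 h => by
      rw [hset t h0 h]
      exact hF.measurableSet_faultCount_eq_zero (by linarith) (by linarith) hx)
    (fun t h0 h => by
      rw [hset t h0 h, hF.prob_faultCount_eq_zero (by linarith) (by linarith) hx]
      simp)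
  have h3 := integral_add_ite_mul hi hE x c (-1)
  have h4 : (fun ω => x + -1 * T ω + E.indicator (fun _ => c) ω) = R := by
    ext ω; simp only [T]; ring
  rw [h4, hv, hF.prob_faultCount_eq_zero he hxe hx, neg_one_mul, ← sub_eq_add_neg] at h3
  exact h3

/-! ### Shares against a fixed set of competitors -/

open Classical in
/-- `lam` times the expected market to the right of a server at `y` when the other servers occupy
the set `S`. -/
def rightShare (lam : ℝ) (S : Finset ℝ) (y : ℝ) : ℝ :=
  if h : (S.filter (fun z => y < z)).Nonempty then
    innerShare (lam * ((S.filter (fun z => y < z)).min' h - y))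
  else endShare (lam * (1 - y))

open Classical in
/-- `lam` times the expected market to the left of a server at `y` when the other servers occupy
the set `S`. -/
def leftShare (lam : ℝ) (S : Finset ℝ) (y : ℝ) : ℝ :=
  if h : (S.filter (fun z => z < y)).Nonempty then
    innerShare (lam * (y - (S.filter (fun z => z < y)).max' h))
  else endShare (lam * y)

/-- The locations of the competitors of player `i`. -/
def others {n : ℕ} (x : Fin n → ℝ) (i : Fin n) : Finset ℝ :=
  (Finset.univ.filter (fun j => j ≠ i)).image x

theorem mem_others {n : ℕ} {x : Fin n → ℝ} {i : Fin n} {y : ℝ} :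
    y ∈ others x i ↔ ∃ j, j ≠ i ∧ x j = y := by
  simp [others]

theorem serversRight_eq {n : ℕ} (x : Fin n → ℝ) (i : Fin n) :
    serversRight x i = (others x i).filter (fun z => x i < z) := by
  ext y
  simp only [serversRight, others, Finset.mem_filter, Finset.mem_image, Finset.mem_univ, true_and]
  constructor
  · rintro ⟨⟨j, rfl⟩, h⟩
    exact ⟨⟨j, by rintro rfl; exact lt_irrefl _ h, rfl⟩, h⟩
  · rintro ⟨⟨j, -, rfl⟩, h⟩
    exact ⟨⟨j, rfl⟩, h⟩

theorem serversLeft_eq {n : ℕ} (x : Fin n → ℝ) (i : Fin n) :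
    serversLeft x i = (others x i).filter (fun z => z < x i) := by
  ext y
  simp only [serversLeft, others, Finset.mem_filter, Finset.mem_image, Finset.mem_univ, true_and]
  constructor
  · rintro ⟨⟨j, rfl⟩, h⟩
    exact ⟨⟨j, by rintro rfl; exact lt_irrefl _ h, rfl⟩, h⟩
  · rintro ⟨⟨j, -, rfl⟩, h⟩
    exact ⟨⟨j, rfl⟩, h⟩

theorem integral_marketRight {Ω : Type*} [MeasurableSpace Ω] {P : Measure Ω}
    [IsProbabilityMeasure P] {F : Ω → Finset ℝ} {lam : ℝ} (hlam : 0 < lam)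
    (hF : IsPoissonFaults P F lam) {n : ℕ} {x : Fin n → ℝ} (hx : ∀ i, x i ∈ Set.Icc (0 : ℝ) 1)
    (i : Fin n) :
    Integrable (fun ω => marketRight (F ω) x i) P ∧ ∫ ω, marketRight (F ω) x i ∂P =
      x i + rightShare lam (others x i) (x i) / lam := by
  by_cases h : (serversRight x i).Nonempty
  · have hmem := Finset.min'_mem _ h
    have hn : rightNeighbor x i = (serversRight x i).min' h := by simp [rightNeighbor, h]
    rw [← hn] at hmem
    obtain ⟨hm1, hm2⟩ := Finset.mem_filter.1 hmem
    obtain ⟨j, -, hj⟩ := Finset.mem_image.1 hm1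
    have := integral_first_fault_right hlam hF (hx i).1 hm2.le (hj ▸ (hx j).2)
      (-((rightNeighbor x i - x i) / 2)) (R := fun ω => marketRight (F ω) x i)
      (fun ω hω => by
        have : (rightFaults (F ω) x i).Nonempty := hω
        simp only [marketRight, this, dif_pos]; rfl)
      (fun ω hω => by
        have : ¬ (rightFaults (F ω) x i).Nonempty := hω
        simp only [marketRight, this, dif_neg, not_false_eq_true, h, if_true]; ring)
    refine ⟨this.1, this.2.trans ?_⟩
    have h' := h
    rw [serversRight_eq] at h'
    have hn' : ((others x i).filter (fun z => x i < z)).min' h' = rightNeighbor x i := by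
      rw [hn]; congr 1; rw [serversRight_eq]
    rw [rightShare, dif_pos h', hn', innerShare]
    field_simp
    ring
  · have hn : rightNeighbor x i = 2 := by simp [rightNeighbor, h]
    -- The default neighbor `2` is harmless: all faults lie in `[0, 1]`, so the cut at `2` selects
    -- the same faults as a cut at `1`.
    have hfil : ∀ ω, rightFaults (F ω) x i = (F ω).filter (fun f => x i ≤ f ∧ f ≤ 1) := by
      intro ω
      refine Finset.filter_congr fun f hf => ?_
      rw [hn]
      have := (hF.mem_unit ω f hf).2
      exact and_congr_right fun _ => ⟨fun _ => this, fun _ => by linarith⟩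
    have := integral_first_fault_right hlam hF (hx i).1 (hx i).2 le_rfl 0
      (R := fun ω => marketRight (F ω) x i)
      (fun ω hω => by
        have : (rightFaults (F ω) x i).Nonempty := by rw [hfil]; exact hω
        simp only [marketRight, this, dif_pos]
        congr 1; exact hfil ω)
      (fun ω hω => by
        have : ¬ (rightFaults (F ω) x i).Nonempty := by rw [hfil]; exact hω
        simp only [marketRight, this, dif_neg, not_false_eq_true, h, if_false]; ring)
    refine ⟨this.1, this.2.trans ?_⟩
    rw [serversRight_eq] at h
    rw [rightShare, dif_neg h, endShare]
    ring

theorem integral_marketLeft {Ω : Type*} [MeasurableSpace Ω] {P : Measure Ω}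
    [IsProbabilityMeasure P] {F : Ω → Finset ℝ} {lam : ℝ} (hlam : 0 < lam)
    (hF : IsPoissonFaults P F lam) {n : ℕ} {x : Fin n → ℝ} (hx : ∀ i, x i ∈ Set.Icc (0 : ℝ) 1)
    (i : Fin n) :
    Integrable (fun ω => marketLeft (F ω) x i) P ∧ ∫ ω, marketLeft (F ω) x i ∂P =
      x i - leftShare lam (others x i) (x i) / lam := by
  by_cases h : (serversLeft x i).Nonempty
  · have hmem := Finset.max'_mem _ h
    have hn : leftNeighbor x i = (serversLeft x i).max' h := by simp [leftNeighbor, h]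
    rw [← hn] at hmem
    obtain ⟨hm1, hm2⟩ := Finset.mem_filter.1 hmem
    obtain ⟨j, -, hj⟩ := Finset.mem_image.1 hm1
    have := integral_first_fault_left hlam hF (hj ▸ (hx j).1) hm2.le (hx i).2
      ((x i - leftNeighbor x i) / 2) (R := fun ω => marketLeft (F ω) x i)
      (fun ω hω => by
        have : (leftFaults (F ω) x i).Nonempty := hω
        simp only [marketLeft, this, dif_pos]; rfl)
      (fun ω hω => by
        have : ¬ (leftFaults (F ω) x i).Nonempty := hω
        simp only [marketLeft, this, dif_neg, not_false_eq_true, h, if_true]; ring)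
    refine ⟨this.1, this.2.trans ?_⟩
    have h' := h
    rw [serversLeft_eq] at h'
    have hn' : ((others x i).filter (fun z => z < x i)).max' h' = leftNeighbor x i := by
      rw [hn]; congr 1; rw [serversLeft_eq]
    rw [leftShare, dif_pos h', hn', innerShare]
    field_simp
    ring
  · have hn : leftNeighbor x i = -1 := by simp [leftNeighbor, h]
    have hfil : ∀ ω, leftFaults (F ω) x i = (F ω).filter (fun f => 0 ≤ f ∧ f ≤ x i) := by
      intro ω
      refine Finset.filter_congr fun f hf => ?_
      rw [hn]
      have := (hF.mem_unit ω f hf).1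
      exact and_congr_left fun _ => ⟨fun _ => this, fun _ => by linarith⟩
    have := integral_first_fault_left hlam hF le_rfl (hx i).1 (hx i).2 0
      (R := fun ω => marketLeft (F ω) x i)
      (fun ω hω => by
        have : (leftFaults (F ω) x i).Nonempty := by rw [hfil]; exact hω
        simp only [marketLeft, this, dif_pos]
        congr 1; exact hfil ω)
      (fun ω hω => by
        have : ¬ (leftFaults (F ω) x i).Nonempty := by rw [hfil]; exact hω
        simp only [marketLeft, this, dif_neg, not_false_eq_true, h, if_false]; ring)
    refine ⟨this.1, this.2.trans ?_⟩
    rw [serversLeft_eq] at h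
    rw [leftShare, dif_neg h, endShare]
    simp

/-- The share of a server at `y`, before division among colocated servers, when the other servers
occupy the set `S`. -/
def share (lam : ℝ) (S : Finset ℝ) (y : ℝ) : ℝ := leftShare lam S y + rightShare lam S y

theorem payoff_eq {Ω : Type*} [MeasurableSpace Ω] {P : Measure Ω}
    [IsProbabilityMeasure P] {F : Ω → Finset ℝ} {lam : ℝ} (hlam : 0 < lam)
    (hF : IsPoissonFaults P F lam) {n : ℕ} {x : Fin n → ℝ} (hx : ∀ i, x i ∈ Set.Icc (0 : ℝ) 1)
    (i : Fin n) :
    payoff P F x i = share lam (others x i) (x i) / colocated x i / lam := by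
  obtain ⟨h1, h2⟩ := integral_marketRight hlam hF hx i
  obtain ⟨h3, h4⟩ := integral_marketLeft hlam hF hx i
  simp only [payoff, marketSize]
  rw [integral_sub h1 h3, h2, h4, share]
  field_simp
  ring

/-- A player's own move does not change its set of competitors, so all its deviations are values of
one function `share lam (others x i)`. -/
theorem others_update {n : ℕ} (x : Fin n → ℝ) (i : Fin n) (y : ℝ) :
    others (Function.update x i y) i = others x i := by
  ext z
  simp only [mem_others]
  refine exists_congr fun j => and_congr_right fun hj => ?_
  rw [Function.update_of_ne hj]

/-- The number of competitors of `i` at `y`. -/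
def rivalsAt {n : ℕ} (x : Fin n → ℝ) (i : Fin n) (y : ℝ) : ℕ :=
  (Finset.univ.filter (fun j => j ≠ i ∧ x j = y)).card

theorem colocated_update {n : ℕ} (x : Fin n → ℝ) (i : Fin n) (y : ℝ) :
    colocated (Function.update x i y) i = rivalsAt x i y + 1 := by
  have : Finset.univ.filter (fun j => Function.update x i y j = Function.update x i y i) =
      insert i (Finset.univ.filter (fun j => j ≠ i ∧ x j = y)) := by
    ext j
    by_cases hj : j = i
    · subst hj; simp
    · simp [hj]
  rw [colocated, rivalsAt, this, Finset.card_insert_of_notMem (by simp)]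

theorem rivalsAt_eq_zero {n : ℕ} {x : Fin n → ℝ} {i : Fin n} {y : ℝ} (h : y ∉ others x i) :
    rivalsAt x i y = 0 := by
  rw [mem_others] at h
  push Not at h
  simpa [rivalsAt, Finset.filter_eq_empty_iff] using h

theorem one_le_rivalsAt {n : ℕ} {x : Fin n → ℝ} {i : Fin n} {y : ℝ} (h : y ∈ others x i) :
    1 ≤ rivalsAt x i y := by
  obtain ⟨j, hj, hy⟩ := mem_others.1 h
  exact Finset.card_pos.2 ⟨j, by simp [hj, hy]⟩

/-- The Nash condition in terms of rescaled shares. -/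
theorem isNashEquilibrium_iff {Ω : Type*} [MeasurableSpace Ω] {P : Measure Ω}
    [IsProbabilityMeasure P] {F : Ω → Finset ℝ} {lam : ℝ} (hlam : 0 < lam)
    (hF : IsPoissonFaults P F lam) {n : ℕ} {x : Fin n → ℝ} :
    IsNashEquilibrium P F x ↔ (∀ i, x i ∈ Set.Icc (0 : ℝ) 1) ∧
      ∀ i, ∀ y ∈ Set.Icc (0 : ℝ) 1,
        share lam (others x i) y / (rivalsAt x i y + 1) ≤
          share lam (others x i) (x i) / (rivalsAt x i (x i) + 1) := by
  refine and_congr_right fun hx => forall_congr' fun i => forall₂_congr fun y hy => ?_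
  have hu : ∀ y ∈ Set.Icc (0 : ℝ) 1, payoff P F (Function.update x i y) i =
      share lam (others x i) y / (rivalsAt x i y + 1) / lam := by
    intro y hy
    rw [payoff_eq hlam hF, others_update, colocated_update, Function.update_self]
    · push_cast; rfl
    · intro j
      by_cases hj : j = i
      · subst hj; simpa using hy
      · rw [Function.update_of_ne hj]; exact hx j
  -- Staying put is the deviation to `x i`, so the same formula covers both sides.
  have h1 := hu (x i) (hx i)
  rw [Function.update_eq_self] at h1
  rw [hu y hy, h1, div_le_div_iff_of_pos_right hlam]

/-! ### Evaluation of shares -/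

theorem rightShare_of_next {lam : ℝ} {S : Finset ℝ} {y q : ℝ} (hq : q ∈ S) (hyq : y < q)
    (hmin : ∀ z ∈ S, y < z → q ≤ z) : rightShare lam S y = innerShare (lam * (q - y)) := by
  have hq' : q ∈ S.filter (fun z => y < z) := Finset.mem_filter.2 ⟨hq, hyq⟩
  have h : (S.filter (fun z => y < z)).Nonempty := ⟨q, hq'⟩
  have he : (S.filter (fun z => y < z)).min' h = q := by
    refine le_antisymm (Finset.min'_le _ _ hq') (Finset.le_min' _ _ _ fun z hz => ?_)
    exact hmin z (Finset.mem_filter.1 hz).1 (Finset.mem_filter.1 hz).2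
  rw [rightShare, dif_pos h, he]

theorem rightShare_of_none {lam : ℝ} {S : Finset ℝ} {y : ℝ} (h : ∀ z ∈ S, z ≤ y) :
    rightShare lam S y = endShare (lam * (1 - y)) := by
  rw [rightShare, dif_neg]
  rintro ⟨z, hz⟩
  exact absurd (Finset.mem_filter.1 hz).2 (not_lt.2 (h z (Finset.mem_filter.1 hz).1))

theorem leftShare_of_next {lam : ℝ} {S : Finset ℝ} {y q : ℝ} (hq : q ∈ S) (hyq : q < y)
    (hmax : ∀ z ∈ S, z < y → z ≤ q) : leftShare lam S y = innerShare (lam * (y - q)) := by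
  have hq' : q ∈ S.filter (fun z => z < y) := Finset.mem_filter.2 ⟨hq, hyq⟩
  have h : (S.filter (fun z => z < y)).Nonempty := ⟨q, hq'⟩
  have he : (S.filter (fun z => z < y)).max' h = q := by
    refine le_antisymm (Finset.max'_le _ _ _ fun z hz => ?_) (Finset.le_max' _ _ hq')
    exact hmax z (Finset.mem_filter.1 hz).1 (Finset.mem_filter.1 hz).2
  rw [leftShare, dif_pos h, he]

theorem leftShare_of_none {lam : ℝ} {S : Finset ℝ} {y : ℝ} (h : ∀ z ∈ S, y ≤ z) :
    leftShare lam S y = endShare (lam * y) := by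
  rw [leftShare, dif_neg]
  rintro ⟨z, hz⟩
  exact absurd (Finset.mem_filter.1 hz).2 (not_lt.2 (h z (Finset.mem_filter.1 hz).1))

theorem exists_next_right {S : Finset ℝ} {y : ℝ} (h : ∃ z ∈ S, y < z) :
    ∃ q ∈ S, y < q ∧ ∀ z ∈ S, y < z → q ≤ z := by
  obtain ⟨z, hz, hyz⟩ := h
  have hne : (S.filter (fun z => y < z)).Nonempty := ⟨z, Finset.mem_filter.2 ⟨hz, hyz⟩⟩
  have hm := Finset.mem_filter.1 (Finset.min'_mem _ hne)
  exact ⟨_, hm.1, hm.2, fun w hw hyw => Finset.min'_le _ _ (Finset.mem_filter.2 ⟨hw, hyw⟩)⟩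

theorem exists_next_left {S : Finset ℝ} {y : ℝ} (h : ∃ z ∈ S, z < y) :
    ∃ q ∈ S, q < y ∧ ∀ z ∈ S, z < y → z ≤ q := by
  obtain ⟨z, hz, hyz⟩ := h
  have hne : (S.filter (fun z => z < y)).Nonempty := ⟨z, Finset.mem_filter.2 ⟨hz, hyz⟩⟩
  have hm := Finset.mem_filter.1 (Finset.max'_mem _ hne)
  exact ⟨_, hm.1, hm.2, fun w hw hyw => Finset.le_max' _ _ (Finset.mem_filter.2 ⟨hw, hyw⟩)⟩

theorem rightShare_nonneg {lam : ℝ} (hlam : 0 ≤ lam) {S : Finset ℝ} {y : ℝ} (hy : y ≤ 1) :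
    0 ≤ rightShare lam S y := by
  by_cases h : ∃ z ∈ S, y < z
  · obtain ⟨q, hq, hyq, hmin⟩ := exists_next_right h
    rw [rightShare_of_next hq hyq hmin]
    exact innerShare_nonneg (mul_nonneg hlam (by linarith))
  · push Not at h
    rw [rightShare_of_none h]
    exact endShare_nonneg (mul_nonneg hlam (by linarith))

theorem leftShare_nonneg {lam : ℝ} (hlam : 0 ≤ lam) {S : Finset ℝ} {y : ℝ} (hy : 0 ≤ y) :
    0 ≤ leftShare lam S y := by
  by_cases h : ∃ z ∈ S, z < y
  · obtain ⟨q, hq, hyq, hmin⟩ := exists_next_left h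
    rw [leftShare_of_next hq hyq hmin]
    exact innerShare_nonneg (mul_nonneg hlam (by linarith))
  · push Not at h
    rw [leftShare_of_none h]
    exact endShare_nonneg (mul_nonneg hlam hy)

/-! ### Derivatives of shares inside a gap -/

theorem hasDerivAt_innerShare_sub_left (lam q y : ℝ) :
    HasDerivAt (fun y => innerShare (lam * (y - q)))
      (lam * (Real.exp (-(lam * (y - q))) * (1 + lam * (y - q)) / 2)) y := by
  have h : HasDerivAt (fun y => lam * (y - q)) lam y := by
    simpa using ((hasDerivAt_id y).sub_const q).const_mul lam
  exact ((hasDerivAt_innerShare _).comp y h).congr_deriv (mul_comm _ _)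

theorem hasDerivAt_innerShare_sub_right (lam q y : ℝ) :
    HasDerivAt (fun y => innerShare (lam * (q - y)))
      (-(lam * (Real.exp (-(lam * (q - y))) * (1 + lam * (q - y)) / 2))) y := by
  have h : HasDerivAt (fun y => lam * (q - y)) (-lam) y := by
    simpa using ((hasDerivAt_id y).const_sub q).const_mul lam
  exact ((hasDerivAt_innerShare _).comp y h).congr_deriv (by ring)

theorem hasDerivAt_endShare_left (lam y : ℝ) :
    HasDerivAt (fun y => endShare (lam * y)) (lam * Real.exp (-(lam * y))) y := by
  have h : HasDerivAt (fun y => lam * y) lam y := by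
    simpa using (hasDerivAt_id y).const_mul lam
  exact ((hasDerivAt_endShare _).comp y h).congr_deriv (mul_comm _ _)

theorem hasDerivAt_endShare_right (lam y : ℝ) :
    HasDerivAt (fun y => endShare (lam * (1 - y))) (-(lam * Real.exp (-(lam * (1 - y))))) y := by
  have h : HasDerivAt (fun y => lam * (1 - y)) (-lam) y := by
    simpa using ((hasDerivAt_id y).const_sub 1).const_mul lam
  exact ((hasDerivAt_endShare _).comp y h).congr_deriv (by ring)

/-! ### No colocation in equilibrium -/

/-- A deviator slightly to the left of `p` loses on its left at rate `exp (-a) * (1 + a) / 2 < 1/2`,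
with `a` the gap to the left neighbor, and gains on its right, in the gap to `p`, at rate `1/2`. So
some vacant point is worth strictly more than the left share at `p` alone. -/
theorem leftShare_lt_of_colocated {lam v p : ℝ} (hlam : 0 < lam) {S : Finset ℝ} (hp : p ∈ S)
    (hp1 : p ≤ 1) (hS : ∀ z ∈ S, 0 ≤ z)
    (hv : ∀ y ∈ Set.Icc (0 : ℝ) 1, y ∉ S → share lam S y ≤ v) (hl : ∃ z ∈ S, z < p) :
    leftShare lam S p < v := by
  obtain ⟨q, hq, hqp, hmax⟩ := exists_next_left hl
  have hpos : 0 < lam * (p - q) := mul_pos hlam (by linarith)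
  have hd := (hasDerivAt_innerShare_sub_left lam q p).add
    (hasDerivAt_innerShare_sub_right lam p p)
  obtain ⟨y, hy1, hy2, hy3⟩ := exists_gt_of_hasDerivAt_neg hd
    (by
      have := mul_lt_mul_of_pos_left (exp_neg_mul_one_add_lt_one hpos) hlam
      simp only [sub_self, mul_zero, neg_zero, Real.exp_zero]
      linarith) (sub_pos.2 hqp)
  rw [sub_sub_cancel] at hy1
  have hnot : ∀ z ∈ S, z ≤ q ∨ p ≤ z := fun z hz => by
    by_cases h : z < p
    · exact Or.inl (hmax z hz h)
    · exact Or.inr (not_lt.1 h)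
  have hyS : y ∉ S := fun h => by
    rcases hnot y h with h | h <;> linarith
  have := hv y ⟨by linarith [hS q hq], by linarith⟩ hyS
  rw [share, leftShare_of_next hq hy1 fun z hz hzy => by
      rcases hnot z hz with h | h <;> linarith,
    rightShare_of_next hp hy2 fun z hz hzy => by
      rcases hnot z hz with h | h <;> linarith] at this
  rw [leftShare_of_next hq hqp hmax]
  simp only [Pi.add_apply, sub_self, mul_zero, innerShare_zero, add_zero] at hy3
  linarith

theorem rightShare_lt_of_colocated {lam v p : ℝ} (hlam : 0 < lam) {S : Finset ℝ} (hp : p ∈ S)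
    (hp0 : 0 ≤ p) (hS : ∀ z ∈ S, z ≤ 1)
    (hv : ∀ y ∈ Set.Icc (0 : ℝ) 1, y ∉ S → share lam S y ≤ v) (hr : ∃ z ∈ S, p < z) :
    rightShare lam S p < v := by
  obtain ⟨q, hq, hqp, hmin⟩ := exists_next_right hr
  have hpos : 0 < lam * (q - p) := mul_pos hlam (by linarith)
  have hd := (hasDerivAt_innerShare_sub_left lam p p).add
    (hasDerivAt_innerShare_sub_right lam q p)
  obtain ⟨y, hy1, hy2, hy3⟩ := exists_gt_of_hasDerivAt_pos hd
    (by
      have := mul_lt_mul_of_pos_left (exp_neg_mul_one_add_lt_one hpos) hlam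
      simp only [sub_self, mul_zero, neg_zero, Real.exp_zero]
      linarith) (sub_pos.2 hqp)
  rw [add_sub_cancel] at hy2
  have hnot : ∀ z ∈ S, z ≤ p ∨ q ≤ z := fun z hz => by
    by_cases h : p < z
    · exact Or.inr (hmin z hz h)
    · exact Or.inl (not_lt.1 h)
  have hyS : y ∉ S := fun h => by
    rcases hnot y h with h | h <;> linarith
  have := hv y ⟨by linarith, by linarith [hS q hq]⟩ hyS
  rw [share, leftShare_of_next hp hy1 fun z hz hzy => by
      rcases hnot z hz with h | h <;> linarith,
    rightShare_of_next hq hy2 fun z hz hzy => by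
      rcases hnot z hz with h | h <;> linarith] at this
  rw [rightShare_of_next hq hqp hmin]
  simp only [Pi.add_apply, sub_self, mul_zero, innerShare_zero, zero_add] at hy3
  linarith

/-- Without a server on the left the loss rate `exp (-(lam * p))` may exceed `1/2`, so only the weak
inequality survives, as a limit of deviations approaching `p` from the left. -/
theorem leftShare_le_of_colocated {lam v p : ℝ} (hlam : 0 < lam) {S : Finset ℝ}
    (hp01 : p ∈ Set.Icc (0 : ℝ) 1) (hv0 : 0 ≤ v)
    (hv : ∀ y ∈ Set.Icc (0 : ℝ) 1, y ∉ S → share lam S y ≤ v) (hl : ∀ z ∈ S, p ≤ z) :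
    leftShare lam S p ≤ v := by
  rw [leftShare_of_none hl]
  rcases hp01.1.eq_or_lt with rfl | h0
  · simpa using hv0
  have hc : Filter.Tendsto (fun y => endShare (lam * y)) (nhdsWithin p (Set.Iio p))
      (nhds (endShare (lam * p))) :=
    (hasDerivAt_endShare_left lam p).continuousAt.continuousWithinAt
  refine le_of_tendsto hc ?_
  filter_upwards [Ioo_mem_nhdsLT h0] with y hy
  have h1 := hv y ⟨hy.1.le, hy.2.le.trans hp01.2⟩ fun h => absurd (hl y h) (not_le.2 hy.2)
  rw [share, leftShare_of_none fun z hz => hy.2.le.trans (hl z hz)] at h1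
  linarith [rightShare_nonneg hlam.le (S := S) (hy.2.le.trans hp01.2)]

theorem rightShare_le_of_colocated {lam v p : ℝ} (hlam : 0 < lam) {S : Finset ℝ}
    (hp01 : p ∈ Set.Icc (0 : ℝ) 1) (hv0 : 0 ≤ v)
    (hv : ∀ y ∈ Set.Icc (0 : ℝ) 1, y ∉ S → share lam S y ≤ v) (hl : ∀ z ∈ S, z ≤ p) :
    rightShare lam S p ≤ v := by
  rw [rightShare_of_none hl]
  rcases hp01.2.eq_or_lt with rfl | h0
  · simpa using hv0
  have hc : Filter.Tendsto (fun y => endShare (lam * (1 - y))) (nhdsWithin p (Set.Ioi p))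
      (nhds (endShare (lam * (1 - p)))) :=
    (hasDerivAt_endShare_right lam p).continuousAt.continuousWithinAt
  refine le_of_tendsto hc ?_
  filter_upwards [Ioo_mem_nhdsGT h0] with y hy
  have h1 := hv y ⟨hp01.1.trans hy.1.le, hy.2.le⟩ fun h => absurd (hl y h) (not_le.2 hy.1)
  rw [share, rightShare_of_none fun z hz => (hl z hz).trans hy.1.le] at h1
  linarith [leftShare_nonneg hlam.le (S := S) (hp01.1.trans hy.1.le)]

/-- The Nash condition in terms of shares. -/
def IsShareEquilibrium (lam : ℝ) {n : ℕ} (x : Fin n → ℝ) : Prop :=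
  (∀ i, x i ∈ Set.Icc (0 : ℝ) 1) ∧ ∀ i, ∀ y ∈ Set.Icc (0 : ℝ) 1,
    share lam (others x i) y / (rivalsAt x i y + 1) ≤
      share lam (others x i) (x i) / (rivalsAt x i (x i) + 1)

/-- With `r ≥ 1` rivals at `p` and payoff `v`, the two sides at `p` sum to `(r + 1) * v`, yet
stepping aside shows that each is at most `v`, strictly if a competitor lies on that side. This is
contradictory unless everybody is at `p`, and then `r = n - 1 ≥ 2` and `v > 0` give `3 * v ≤ 2 * v`.
-/
theorem IsShareEquilibrium.injective {lam : ℝ} (hlam : 0 < lam) {n : ℕ} (hn : 3 ≤ n)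
    {x : Fin n → ℝ} (hx : IsShareEquilibrium lam x) : Function.Injective x := by
  intro i j hij
  by_contra hne
  obtain ⟨h01, hnash⟩ := hx
  set S := others x i with hSdef
  set p := x i with hp
  have hpS : p ∈ S := mem_others.2 ⟨j, fun h => hne h.symm, hij.symm⟩
  set r := rivalsAt x i p with hr
  have hr1 : (1 : ℝ) ≤ r := by exact_mod_cast one_le_rivalsAt hpS
  have hLn := leftShare_nonneg hlam.le (S := S) (h01 i).1
  have hRn := rightShare_nonneg hlam.le (S := S) (h01 i).2
  set v := share lam S p / (r + 1) with hvdef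
  have hvmul : v * (r + 1) = leftShare lam S p + rightShare lam S p := by
    rw [hvdef, div_mul_cancel₀ _ (by linarith), share]
  have hv0 : 0 ≤ v := div_nonneg (add_nonneg hLn hRn) (by linarith)
  have hv : ∀ y ∈ Set.Icc (0 : ℝ) 1, y ∉ S → share lam S y ≤ v := by
    intro y hy hyS
    have := hnash i y hy
    rwa [rivalsAt_eq_zero hyS, Nat.cast_zero, zero_add, div_one] at this
  have hS0 : ∀ z ∈ S, z ∈ Set.Icc (0 : ℝ) 1 := by
    intro z hz
    obtain ⟨k, -, rfl⟩ := mem_others.1 hz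
    exact h01 k
  have hL : leftShare lam S p ≤ v := by
    by_cases h : ∃ z ∈ S, z < p
    · exact (leftShare_lt_of_colocated hlam hpS (h01 i).2 (fun z hz => (hS0 z hz).1) hv h).le
    · push Not at h
      exact leftShare_le_of_colocated hlam (h01 i) hv0 hv h
  have hR : rightShare lam S p ≤ v := by
    by_cases h : ∃ z ∈ S, p < z
    · exact (rightShare_lt_of_colocated hlam hpS (h01 i).1 (fun z hz => (hS0 z hz).2) hv h).le
    · push Not at h
      exact rightShare_le_of_colocated hlam (h01 i) hv0 hv h
  have h2v : v * 2 ≤ v * (r + 1) := mul_le_mul_of_nonneg_left (by linarith) hv0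
  by_cases h1 : ∃ z ∈ S, z < p
  · have := leftShare_lt_of_colocated hlam hpS (h01 i).2 (fun z hz => (hS0 z hz).1) hv h1
    linarith
  by_cases h2 : ∃ z ∈ S, p < z
  · have := rightShare_lt_of_colocated hlam hpS (h01 i).1 (fun z hz => (hS0 z hz).2) hv h2
    linarith
  push Not at h1 h2
  have hr2 : (2 : ℝ) ≤ r := by
    have hfil : Finset.univ.filter (fun k => k ≠ i ∧ x k = p) = Finset.univ.erase i := by
      ext k
      simp only [Finset.mem_filter, Finset.mem_univ, true_and, Finset.mem_erase, and_true,
        and_iff_left_iff_imp]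
      intro hk
      have hkS : x k ∈ S := mem_others.2 ⟨k, hk, rfl⟩
      exact le_antisymm (h2 _ hkS) (h1 _ hkS)
    have : r = n - 1 := by
      rw [hr, rivalsAt, hfil, Finset.card_erase_of_mem (Finset.mem_univ _), Finset.card_fin]
    have : 2 ≤ r := by omega
    exact_mod_cast this
  have hvpos : 0 < v := by
    by_contra! hle
    have hv' : v = 0 := le_antisymm hle hv0
    rw [hv', zero_mul, leftShare_of_none h1, rightShare_of_none h2] at hvmul
    have e1 : 0 ≤ endShare (lam * p) := endShare_nonneg (mul_nonneg hlam.le (h01 i).1)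
    have e2 : 0 ≤ endShare (lam * (1 - p)) :=
      endShare_nonneg (mul_nonneg hlam.le (by linarith [(h01 i).2]))
    have e3 : endShare (lam * p) = 0 := by linarith
    have e4 : endShare (lam * (1 - p)) = 0 := by linarith
    simp only [endShare, sub_eq_zero] at e3 e4
    have e5 := Real.exp_eq_one_iff _ |>.1 e3.symm
    have e6 := Real.exp_eq_one_iff _ |>.1 e4.symm
    have : lam = 0 := by linear_combination -e5 - e6
    exact hlam.ne' this
  have h3 : v * 3 ≤ v * (r + 1) := mul_le_mul_of_nonneg_left (by linarith) hv0
  linarith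

/-! ### Equilibria with ordered locations -/

theorem others_comp_equiv {n : ℕ} (x : Fin n → ℝ) (σ : Equiv.Perm (Fin n)) (i : Fin n) :
    others (x ∘ σ) i = others x (σ i) := by
  ext y
  simp only [mem_others, Function.comp]
  constructor
  · rintro ⟨j, hj, rfl⟩
    exact ⟨σ j, fun h => hj (σ.injective h), rfl⟩
  · rintro ⟨j, hj, rfl⟩
    exact ⟨σ.symm j, fun h => hj (by rw [← h, Equiv.apply_symm_apply]), by simp⟩

/-- Payoffs are invariant under relabeling, so the servers may be sorted. Of the Nash condition only
deviations to vacant points are kept, where no division among servers occurs. -/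
theorem IsShareEquilibrium.exists_strictMono {lam : ℝ} (hlam : 0 < lam) {n : ℕ} (hn : 3 ≤ n)
    {x : Fin n → ℝ} (hx : IsShareEquilibrium lam x) :
    ∃ e : Fin n → ℝ, StrictMono e ∧ (∀ i, e i ∈ Set.Icc (0 : ℝ) 1) ∧
      ∀ i, ∀ y ∈ Set.Icc (0 : ℝ) 1, y ∉ others e i →
        share lam (others e i) y ≤ share lam (others e i) (e i) := by
  have hinj := hx.injective hlam hn
  refine ⟨x ∘ Tuple.sort x, (Tuple.monotone_sort x).strictMono_of_injective
    (hinj.comp (Equiv.injective _)), fun i => hx.1 _, fun i y hy hyS => ?_⟩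
  rw [others_comp_equiv] at hyS ⊢
  have h := hx.2 (Tuple.sort x i) y hy
  have hself : x (Tuple.sort x i) ∉ others x (Tuple.sort x i) := fun h => by
    obtain ⟨j, hj, hj2⟩ := mem_others.1 h
    exact hj (hinj hj2)
  rw [rivalsAt_eq_zero hyS, rivalsAt_eq_zero hself] at h
  simpa using h

section ordered

variable {n : ℕ} {e : Fin n → ℝ}

theorem mem_others_of_ne {i j : Fin n} (h : j ≠ i) : e j ∈ others e i := mem_others.2 ⟨j, h, rfl⟩

theorem share_inner (he : StrictMono e) (lam : ℝ) {k : ℕ} (hk : k + 2 < n) {y : ℝ}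
    (h1 : e ⟨k, by omega⟩ < y) (h2 : y < e ⟨k + 2, hk⟩) :
    y ∉ others e ⟨k + 1, by omega⟩ ∧ share lam (others e ⟨k + 1, by omega⟩) y =
      innerShare (lam * (y - e ⟨k, by omega⟩)) + innerShare (lam * (e ⟨k + 2, hk⟩ - y)) := by
  have hsplit : ∀ z ∈ others e ⟨k + 1, by omega⟩, z ≤ e ⟨k, by omega⟩ ∨ e ⟨k + 2, hk⟩ ≤ z := by
    intro z hz
    obtain ⟨j, hj, rfl⟩ := mem_others.1 hz
    have hj' : (j : ℕ) ≠ k + 1 := fun h => hj (Fin.ext h)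
    by_cases hjk : (j : ℕ) ≤ k
    · exact Or.inl (he.monotone (Fin.mk_le_of_le_val (by simpa using hjk)))
    · exact Or.inr (he.monotone (Fin.mk_le_of_le_val (by omega)))
  refine ⟨fun h => by rcases hsplit y h with h | h <;> linarith, ?_⟩
  rw [share, leftShare_of_next (mem_others_of_ne (by simp)) h1 fun z hz hzy => by
      rcases hsplit z hz with h | h <;> linarith,
    rightShare_of_next (mem_others_of_ne (by simp)) h2 fun z hz hzy => by
      rcases hsplit z hz with h | h <;> linarith]

theorem share_first (he : StrictMono e) (lam : ℝ) (hn : 2 ≤ n) {y : ℝ} (h : y < e ⟨1, by omega⟩) :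
    y ∉ others e ⟨0, by omega⟩ ∧ share lam (others e ⟨0, by omega⟩) y =
      endShare (lam * y) + innerShare (lam * (e ⟨1, by omega⟩ - y)) := by
  have hge : ∀ z ∈ others e ⟨0, by omega⟩, e ⟨1, by omega⟩ ≤ z := by
    intro z hz
    obtain ⟨j, hj, rfl⟩ := mem_others.1 hz
    have hj' : (j : ℕ) ≠ 0 := fun h => hj (Fin.ext h)
    exact he.monotone (Fin.mk_le_of_le_val (by omega))
  refine ⟨fun hy => by linarith [hge y hy], ?_⟩
  rw [share, leftShare_of_none fun z hz => (h.trans_le (hge z hz)).le,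
    rightShare_of_next (mem_others_of_ne (by simp)) h fun z hz _ => hge z hz]

theorem share_last (he : StrictMono e) (lam : ℝ) (hn : 2 ≤ n) {y : ℝ}
    (h : e ⟨n - 2, by omega⟩ < y) :
    y ∉ others e ⟨n - 1, by omega⟩ ∧ share lam (others e ⟨n - 1, by omega⟩) y =
      innerShare (lam * (y - e ⟨n - 2, by omega⟩)) + endShare (lam * (1 - y)) := by
  have hle : ∀ z ∈ others e ⟨n - 1, by omega⟩, z ≤ e ⟨n - 2, by omega⟩ := by
    intro z hz
    obtain ⟨j, hj, rfl⟩ := mem_others.1 hz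
    have hj' : (j : ℕ) ≠ n - 1 := fun h => hj (Fin.ext h)
    have hj2 := j.2
    exact he.monotone (Fin.le_def.2 (by simp only; omega))
  refine ⟨fun hy => by linarith [hle y hy], ?_⟩
  rw [share, rightShare_of_none fun z hz => ((hle z hz).trans_lt h).le,
    leftShare_of_next (mem_others_of_ne (by simp; omega)) h fun z hz _ => hle z hz]

/-- This is the jump of a server other than the first into the left end gap. -/
theorem share_before_first (he : StrictMono e) (lam : ℝ) {i : Fin n} (hi : 0 < (i : ℕ)) {y : ℝ}
    (h : y < e ⟨0, by omega⟩) : y ∉ others e i ∧ share lam (others e i) y =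
      endShare (lam * y) + innerShare (lam * (e ⟨0, by omega⟩ - y)) := by
  have hge : ∀ z ∈ others e i, e ⟨0, by omega⟩ ≤ z := by
    intro z hz
    obtain ⟨j, hj, rfl⟩ := mem_others.1 hz
    exact he.monotone (Fin.mk_le_of_le_val (by omega))
  refine ⟨fun hy => by linarith [hge y hy], ?_⟩
  rw [share, leftShare_of_none fun z hz => (h.trans_le (hge z hz)).le,
    rightShare_of_next (mem_others_of_ne fun hh => by rw [← hh] at hi; simp at hi) h
      fun z hz _ => hge z hz]

end ordered

/-! ### Canonical profiles -/

/-- The rescaled gap at either end of the line in a canonical profile with inner gaps `α`. -/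
def endGap (α : ℝ) : ℝ := α - Real.log ((1 + α) / 2)

theorem exp_neg_endGap {α : ℝ} (hα : 0 ≤ α) :
    Real.exp (-endGap α) = Real.exp (-α) * (1 + α) / 2 := by
  rw [endGap, neg_sub, sub_eq_neg_add, Real.exp_add, Real.exp_log (by linarith)]
  ring

theorem eq_endGap {α b : ℝ} (hα : 0 ≤ α) (h : Real.exp (-b) = Real.exp (-α) * (1 + α) / 2) :
    b = endGap α := by
  rw [← exp_neg_endGap hα] at h
  linarith [Real.exp_injective h]

theorem endGap_pos {α : ℝ} (hα : 0 ≤ α) : 0 < endGap α := by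
  have h1 := exp_neg_endGap hα
  have h2 := exp_neg_mul_one_add_le hα
  have : Real.exp (-endGap α) < 1 := by linarith
  linarith [Real.exp_lt_one_iff.1 this]

/-- The rescaled length of the line: two end gaps and `n - 1` inner gaps. -/
theorem threshold_eq (α : ℝ) (n : ℕ) : threshold α n = 2 * endGap α + ((n : ℝ) - 1) * α := by
  simp only [threshold, endGap]; ring

theorem threshold_strictMono {α α' : ℝ} {n : ℕ} (hn : 1 ≤ n) (hα : 0 ≤ α) (h : α < α') :
    threshold α n < threshold α' n := by
  have h1 : Real.log ((1 + α') / (1 + α)) = Real.log ((1 + α') / 2) - Real.log ((1 + α) / 2) := by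
    rw [← Real.log_div (by linarith) (by linarith)]
    congr 1; field_simp
  have h2 := Real.log_le_sub_one_of_pos (show 0 < (1 + α') / (1 + α) by
    apply div_pos <;> linarith)
  have h3 : (1 + α') / (1 + α) - 1 ≤ α' - α := by
    rw [div_sub_one (by linarith), div_le_iff₀ (by linarith)]
    nlinarith
  have hn' : (1 : ℝ) ≤ n := by exact_mod_cast hn
  simp only [threshold]
  rw [h1] at h2
  -- For `n = 1` the linear gain `2 * (α' - α)` only just covers twice the bound on the logarithm.
  -- Strictness comes from the denominator `1 + α` when `α > 0`, and from the strict logarithm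
  -- inequality when `α = 0`.
  by_cases heq : α = 0
  · subst heq
    have h4 := Real.log_lt_sub_one_of_pos (show 0 < (1 + α') / (1 + 0) by
      apply div_pos <;> linarith) (by simp; linarith)
    rw [h1] at h4
    simp only [add_zero, div_one] at *
    nlinarith
  · have h5 : 0 < α := lt_of_le_of_ne hα (Ne.symm heq)
    have h6 : (1 + α') / (1 + α) - 1 < α' - α := by
      rw [div_sub_one (by linarith), div_lt_iff₀ (by linarith)]
      nlinarith
    nlinarith

theorem exists_threshold_eq {α lam : ℝ} {n : ℕ} (hn : 2 ≤ n) (hα : 0 ≤ α)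
    (h : threshold α n ≤ lam) : ∃ α', α ≤ α' ∧ threshold α' n = lam := by
  -- From `log ((1 + M) / 2) ≤ (M - 1) / 2` one gets `threshold M n ≥ n * M + 1`, which exceeds
  -- `lam`.
  set M := max α (max lam 1) with hM
  have hM1 : 1 ≤ M := (le_max_right _ _).trans (le_max_right _ _)
  have hMl : lam ≤ M := (le_max_left lam 1).trans (le_max_right _ _)
  have hn' : (2 : ℝ) ≤ n := by exact_mod_cast hn
  have hc : ContinuousOn (fun a => threshold a n) (Set.Icc α M) := by
    unfold threshold
    refine ContinuousOn.sub (by fun_prop) (ContinuousOn.mul continuousOn_const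
      (ContinuousOn.log (by fun_prop) fun x hx => ?_))
    have := hx.1
    have h0 : 0 < (1 + x) / 2 := by linarith
    exact h0.ne'
  have hbig : lam ≤ threshold M n := by
    have h1 := Real.log_le_sub_one_of_pos (show 0 < (1 + M) / 2 by linarith)
    simp only [threshold]
    nlinarith
  obtain ⟨a, ha, hal⟩ := intermediate_value_Icc (le_max_left α _) hc ⟨h, hbig⟩
  exact ⟨a, ha.1, hal⟩

/-! ### Deviations into an end gap -/

theorem advantage_of_le {α₀ β₀ α β : ℝ} (hα₀ : 0 ≤ α₀) (hβ₀ : 0 ≤ β₀)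
    (h₁ : Real.exp (-α₀) * (1 + α₀) = Real.exp (-2 * β₀) * (1 + β₀))
    (h₂ : Real.exp (-α₀) * (1 + α₀ / 2) = Real.exp (-β₀) * (3 / 4 + β₀ / 2))
    (hα : α₀ ≤ α) (hβ : 0 ≤ β) (h : Real.exp (-α) * (1 + α) = Real.exp (-2 * β) * (1 + β)) :
    Real.exp (-α) * (1 + α / 2) ≤ Real.exp (-β) * (3 / 4 + β / 2) := by
  by_cases h1 : 1 ≤ α
  · exact advantage_nonneg_of_one_le h1 hβ h
  · rcases hα.eq_or_lt with rfl | hlt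
    · have : β = β₀ := by
        by_contra hne
        rcases lt_or_gt_of_ne hne with hl | hl
        · linarith [exp_neg_two_mul_mul_one_add_lt hβ hl]
        · linarith [exp_neg_two_mul_mul_one_add_lt hβ₀ hl]
      rw [this, h₂]
    · linarith [advantage_lt hα₀ hlt (not_le.1 h1).le hβ₀ hβ h₁ h]

/-- The value of a position with balanced marginal shares; this is where the coefficient `3/4` comes
from. -/
theorem endShare_add_innerShare_eq {t s : ℝ}
    (hd : Real.exp (-t) = Real.exp (-s) * (1 + s) / 2) :
    endShare t + innerShare s = 2 - 2 * (Real.exp (-s) * (3 / 4 + s / 2)) := by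
  simp only [endShare, innerShare, hd]; ring

/-- The best position in a peripheral gap of size `endGap α`. -/
theorem exp_neg_best_position {α β : ℝ} (hα : 0 ≤ α)
    (h : Real.exp (-α) * (1 + α) = Real.exp (-2 * β) * (1 + β)) :
    Real.exp (-(endGap α - β)) = Real.exp (-β) * (1 + β) / 2 := by
  have h1 := exp_neg_endGap hα
  have h2 : Real.exp (-(endGap α - β)) = Real.exp (-endGap α) * Real.exp β := by
    rw [← Real.exp_add]; congr 1; ring
  have h3 : Real.exp (-β) = Real.exp (-2 * β) * Real.exp β := by
    rw [← Real.exp_add]; congr 1; ring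
  rw [h2, h1, h, h3]; ring

/-- Concavity makes the balanced position, at distance `β` from the peripheral server, the best one
in the gap; its value is at most `2 * innerShare α` as soon as `α ≥ α₀`. -/
theorem deviation_to_end_le {α₀ β₀ α t : ℝ} (hα₀ : 0 ≤ α₀) (hβ₀ : 0 ≤ β₀)
    (h₁ : Real.exp (-α₀) * (1 + α₀) = Real.exp (-2 * β₀) * (1 + β₀))
    (h₂ : Real.exp (-α₀) * (1 + α₀ / 2) = Real.exp (-β₀) * (3 / 4 + β₀ / 2))
    (hα : α₀ ≤ α) (ht : t ≤ endGap α) :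
    endShare t + innerShare (endGap α - t) ≤ 2 * innerShare α := by
  obtain ⟨β, hβ, -, h⟩ := exists_beta (hα₀.trans hα)
  have hd := exp_neg_best_position (hα₀.trans hα) h
  have h3 := endShare_add_innerShare_le (t := t) (s := endGap α - t) (by linarith) hβ (by ring) hd
  rw [endShare_add_innerShare_eq hd] at h3
  have h4 := advantage_of_le hα₀ hβ₀ h₁ h₂ hα hβ h
  simp only [innerShare] at h3 ⊢
  linarith

/-! ### Equilibria force a canonical profile -/

theorem threshold_le_of_equilibrium {α₀ β₀ lam : ℝ} (hα₀ : α₀ < 1) (hβ₀ : 0 ≤ β₀)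
    (h₁ : Real.exp (-α₀) * (1 + α₀) = Real.exp (-2 * β₀) * (1 + β₀))
    (h₂ : Real.exp (-α₀) * (1 + α₀ / 2) = Real.exp (-β₀) * (3 / 4 + β₀ / 2))
    (hpos : 0 < α₀) (hlam : 0 < lam) {n : ℕ} (hn : 3 ≤ n) {e : Fin n → ℝ} (he : StrictMono e)
    (h01 : ∀ i, e i ∈ Set.Icc (0 : ℝ) 1)
    (hnash : ∀ i, ∀ y ∈ Set.Icc (0 : ℝ) 1, y ∉ others e i →
        share lam (others e i) y ≤ share lam (others e i) (e i)) :
    threshold α₀ n ≤ lam := by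
  have hlt : ∀ {k m : ℕ} (hk : k < n) (hm : m < n), k < m → e ⟨k, hk⟩ < e ⟨m, hm⟩ :=
    fun hk hm h => he (by simpa using h)
  set δ := e ⟨1, by omega⟩ - e ⟨0, by omega⟩ with hδ
  have hδpos : 0 < δ := sub_pos.2 (hlt _ _ (by norm_num))
  -- An inner server can move to the midpoint between its neighbors, which by strict concavity is a
  -- strict gain unless it is already there.
  have hmid : ∀ k (hk : k + 2 < n), e ⟨k + 2, hk⟩ - e ⟨k + 1, by omega⟩ =
      e ⟨k + 1, by omega⟩ - e ⟨k, by omega⟩ := by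
    intro k hk
    have hl1 := hlt (k := k) (m := k + 1) (by omega) (by omega) (by omega)
    have hl2 := hlt (k := k + 1) (m := k + 2) (by omega) hk (by omega)
    obtain ⟨-, hs1⟩ := share_inner he lam hk hl1 hl2
    obtain ⟨hs2, hs3⟩ := share_inner he lam hk
      (y := (e ⟨k, by omega⟩ + e ⟨k + 2, hk⟩) / 2) (by linarith) (by linarith)
    have hle := hnash ⟨k + 1, by omega⟩ _
      ⟨by linarith [(h01 ⟨k, by omega⟩).1], by linarith [(h01 ⟨k + 2, hk⟩).2]⟩ hs2
    rw [hs1, hs3] at hle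
    by_contra hne
    have hstrict := innerShare_add_lt (a := lam * (e ⟨k + 1, by omega⟩ - e ⟨k, by omega⟩))
      (b := lam * (e ⟨k + 2, hk⟩ - e ⟨k + 1, by omega⟩))
      (mul_nonneg hlam.le (by linarith)) (mul_nonneg hlam.le (by linarith))
      (fun h => hne (mul_left_cancel₀ hlam.ne' h).symm)
    have e1 : lam * ((e ⟨k, by omega⟩ + e ⟨k + 2, hk⟩) / 2 - e ⟨k, by omega⟩) =
      (lam * (e ⟨k + 1, by omega⟩ - e ⟨k, by omega⟩) +
        lam * (e ⟨k + 2, hk⟩ - e ⟨k + 1, by omega⟩)) / 2 := by ring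
    have e2 : lam * (e ⟨k + 2, hk⟩ - (e ⟨k, by omega⟩ + e ⟨k + 2, hk⟩) / 2) =
      (lam * (e ⟨k + 1, by omega⟩ - e ⟨k, by omega⟩) +
        lam * (e ⟨k + 2, hk⟩ - e ⟨k + 1, by omega⟩)) / 2 := by ring
    rw [e1, e2] at hle
    linarith
  have hgap : ∀ k (hk : k + 1 < n), e ⟨k + 1, hk⟩ - e ⟨k, by omega⟩ = δ := by
    intro k
    induction k with
    | zero => intro hk; rfl
    | succ k ih => intro hk; rw [hmid k hk, ih]
  have hpos_eq : ∀ k (hk : k < n), e ⟨k, hk⟩ = e ⟨0, by omega⟩ + k * δ := by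
    intro k
    induction k with
    | zero => intro hk; simp
    | succ k ih =>
      intro hk
      have := hgap k hk
      rw [ih (by omega)] at this
      push_cast; linarith
  set α := lam * δ with hα
  have hαpos : 0 < α := mul_pos hlam hδpos
  have hψ := exp_neg_mul_one_add_lt_one hαpos
  -- First-order condition of the first server: any imbalance of its two marginal shares yields a
  -- profitable small move.
  have hfirst : Real.exp (-(lam * e ⟨0, by omega⟩)) = Real.exp (-α) * (1 + α) / 2 := by
    have h0 := (share_first he lam (by omega) (y := e ⟨0, by omega⟩) (hlt _ _ (by norm_num))).2
    have hd := (hasDerivAt_endShare_left lam (e ⟨0, by omega⟩)).add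
      (hasDerivAt_innerShare_sub_right lam (e ⟨1, by omega⟩) (e ⟨0, by omega⟩))
    have hno : ∀ y, 0 ≤ y → y < e ⟨1, by omega⟩ →
        endShare (lam * y) + innerShare (lam * (e ⟨1, by omega⟩ - y)) ≤
        endShare (lam * e ⟨0, by omega⟩) +
          innerShare (lam * (e ⟨1, by omega⟩ - e ⟨0, by omega⟩)) := by
      intro y hy0 hy1
      obtain ⟨hs1, hs2⟩ := share_first he lam (by omega) hy1
      rw [← h0, ← hs2]
      exact hnash _ y ⟨hy0, hy1.le.trans (h01 _).2⟩ hs1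
    rw [← hδ, ← hα] at hd
    rcases lt_trichotomy (Real.exp (-(lam * e ⟨0, by omega⟩))) (Real.exp (-α) * (1 + α) / 2)
      with h | h | h
    -- A move to the left needs room. At `0` the end marginal would be `1`, contradicting that it is
    -- below `exp (-α) * (1 + α) / 2 < 1/2`.
    · have hb : 0 < e ⟨0, by omega⟩ := by
        refine lt_of_le_of_ne (h01 _).1 fun h' => ?_
        rw [← h', mul_zero, neg_zero, Real.exp_zero] at h
        linarith
      obtain ⟨y, hy1, hy2, hy3⟩ := exists_gt_of_hasDerivAt_neg hd
        (by linarith [mul_lt_mul_of_pos_left h hlam]) hb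
      rw [sub_self] at hy1
      exact absurd hy3 (not_lt.2 (hno y hy1.le (hy2.trans (hlt _ _ (by norm_num)))))
    · exact h
    · obtain ⟨y, hy1, hy2, hy3⟩ := exists_gt_of_hasDerivAt_pos hd
        (by linarith [mul_lt_mul_of_pos_left h hlam]) hδpos
      exact absurd hy3 (not_lt.2 (hno y ((h01 _).1.trans hy1.le) (by linarith)))
  have hlastgap : e ⟨n - 1, by omega⟩ - e ⟨n - 2, by omega⟩ = δ := by
    rw [hpos_eq (n - 1), hpos_eq (n - 2), show n - 1 = n - 2 + 1 by omega]
    push_cast; ring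
  have hlast : Real.exp (-(lam * (1 - e ⟨n - 1, by omega⟩))) = Real.exp (-α) * (1 + α) / 2 := by
    have h0 := (share_last he lam (by omega) (y := e ⟨n - 1, by omega⟩)
      (hlt _ _ (by omega))).2
    have hd := (hasDerivAt_innerShare_sub_left lam (e ⟨n - 2, by omega⟩)
      (e ⟨n - 1, by omega⟩)).add (hasDerivAt_endShare_right lam (e ⟨n - 1, by omega⟩))
    have hno : ∀ y, y ≤ 1 → e ⟨n - 2, by omega⟩ < y →
        innerShare (lam * (y - e ⟨n - 2, by omega⟩)) + endShare (lam * (1 - y)) ≤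
        innerShare (lam * (e ⟨n - 1, by omega⟩ - e ⟨n - 2, by omega⟩)) +
          endShare (lam * (1 - e ⟨n - 1, by omega⟩)) := by
      intro y hy0 hy1
      obtain ⟨hs1, hs2⟩ := share_last he lam (by omega) hy1
      rw [← h0, ← hs2]
      exact hnash _ y ⟨(h01 _).1.trans hy1.le, hy0⟩ hs1
    rw [hlastgap, ← hα] at hd
    rcases lt_trichotomy (Real.exp (-(lam * (1 - e ⟨n - 1, by omega⟩))))
      (Real.exp (-α) * (1 + α) / 2) with h | h | h
    · have hb : 0 < 1 - e ⟨n - 1, by omega⟩ := by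
        refine lt_of_le_of_ne (sub_nonneg.2 (h01 _).2) fun h' => ?_
        rw [← h', mul_zero, neg_zero, Real.exp_zero] at h
        linarith
      obtain ⟨y, hy1, hy2, hy3⟩ := exists_gt_of_hasDerivAt_pos hd
        (by linarith [mul_lt_mul_of_pos_left h hlam]) hb
      exact absurd hy3 (not_lt.2 (hno y (by linarith) ((hlt _ _ (by omega)).trans hy1)))
    · exact h
    · obtain ⟨y, hy1, hy2, hy3⟩ := exists_gt_of_hasDerivAt_neg hd
        (by linarith [mul_lt_mul_of_pos_left h hlam]) hδpos
      exact absurd hy3 (not_lt.2 (hno y (hy2.le.trans (h01 _).2) (by linarith)))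
  have hb1 := eq_endGap hαpos.le hfirst
  have hb2 := eq_endGap hαpos.le hlast
  have htotal : threshold α n = lam := by
    have h := hpos_eq (n - 1) (by omega)
    rw [h, Nat.cast_sub (by omega)] at hb2
    rw [threshold_eq]
    push_cast at hb2
    rw [hα] at hb1 hb2 ⊢
    linarith
  suffices hge : α₀ ≤ α by
    rcases hge.eq_or_lt with h | h
    · rw [h, htotal]
    · exact ((threshold_strictMono (by omega) hpos.le h).le).trans htotal.le
  -- If `α < α₀`, the server of index `1`, which is inner because `n ≥ 3`, gains by jumping to
  -- rescaled position `endGap α - β`. Positivity of `β` places that point strictly before the first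
  -- server.
  by_contra! hlt0
  obtain ⟨β, hβ, -, h⟩ := exists_beta hαpos.le
  have hβpos : 0 < β := by
    refine lt_of_le_of_ne hβ fun h' => ?_
    rw [← h'] at h
    simp at h
    linarith
  have hd := exp_neg_best_position hαpos.le h
  have ht : 0 < endGap α - β := by
    have h3 := exp_neg_mul_one_add_le hβ
    have h4 : Real.exp (-(endGap α - β)) < 1 := by linarith
    linarith [Real.exp_lt_one_iff.1 h4]
  have hbest := endShare_add_innerShare_eq hd
  have hadv := advantage_lt hαpos.le hlt0 hα₀.le hβ hβ₀ h h₁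
  have hy : (endGap α - β) / lam < e ⟨0, by omega⟩ := by
    rw [div_lt_iff₀ hlam, mul_comm, hb1]; linarith
  obtain ⟨hs1, hs2⟩ := share_before_first he lam (i := ⟨1, by omega⟩) (by simp) hy
  have hle := hnash ⟨1, by omega⟩ _ ⟨div_nonneg ht.le hlam.le, hy.le.trans (h01 _).2⟩ hs1
  have hs3 := (share_inner he lam (k := 0) (by omega) (y := e ⟨0 + 1, by omega⟩)
    (hlt _ _ (by norm_num)) (hlt _ _ (by norm_num))).2
  rw [hgap 0 (by omega), hmid 0 (by omega), hgap 0 (by omega), ← hα] at hs3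
  have e1 : lam * ((endGap α - β) / lam) = endGap α - β := mul_div_cancel₀ _ hlam.ne'
  have e2 : lam * (e ⟨0, by omega⟩ - (endGap α - β) / lam) = β := by
    rw [mul_sub, e1, hb1]; ring
  rw [hs2, e1, e2, hbest] at hle
  have hs4 : share lam (others e ⟨1, by omega⟩) (e ⟨1, by omega⟩) = innerShare α + innerShare α :=
    hs3
  rw [hs4] at hle
  simp only [innerShare] at hle
  linarith

/-! ### Canonical profiles are equilibria -/

/-- The canonical profile with rescaled inner gaps `α`. -/
def canonicalProfile (lam α : ℝ) (n : ℕ) (i : Fin n) : ℝ := (endGap α + (i : ℕ) * α) / lam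

section canonical

variable {lam α : ℝ} {n : ℕ}

theorem mul_canonicalProfile (hlam : 0 < lam) (i : Fin n) :
    lam * canonicalProfile lam α n i = endGap α + (i : ℕ) * α :=
  mul_div_cancel₀ _ hlam.ne'

theorem canonicalProfile_strictMono (hlam : 0 < lam) (hα : 0 < α) :
    StrictMono (canonicalProfile lam α n) := by
  intro i j hij
  have : ((i : ℕ) : ℝ) < (j : ℕ) := by exact_mod_cast hij
  exact div_lt_div_of_pos_right (by nlinarith) hlam

theorem mul_one_sub_canonicalProfile (hlam : 0 < lam) (hn : 1 ≤ n) (ht : threshold α n = lam) :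
    lam * (1 - canonicalProfile lam α n ⟨n - 1, by omega⟩) = endGap α := by
  rw [mul_sub, mul_canonicalProfile hlam, mul_one]
  nth_rewrite 1 [← ht]
  rw [threshold_eq]
  push_cast [Nat.cast_sub hn]
  ring

theorem canonicalProfile_mem (hlam : 0 < lam) (hα : 0 < α) (ht : threshold α n = lam) (i : Fin n) :
    canonicalProfile lam α n i ∈ Set.Icc (0 : ℝ) 1 := by
  have hb := endGap_pos hα.le
  refine ⟨div_nonneg (by positivity) hlam.le, ?_⟩
  have hi := i.2
  have h1 := (canonicalProfile_strictMono (n := n) hlam hα).monotone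
    (show i ≤ ⟨n - 1, by omega⟩ from Fin.le_def.2 (by simp only; omega))
  have h2 := mul_one_sub_canonicalProfile hlam (by omega) ht
  have h3 : 0 < 1 - canonicalProfile lam α n ⟨n - 1, by omega⟩ := by
    by_contra! hle
    nlinarith
  linarith

/-- Removing one server merges at most two inner gaps: if `m > k + 2`, one of `k + 1`, `k + 2`
differs from `i` and lies strictly between. -/
theorem canonicalProfile_gap_le (hlam : 0 < lam) (hα : 0 < α) {i k m : Fin n}
    (h : ∀ p, p ≠ i → k < p → ¬ p < m) :
    lam * (canonicalProfile lam α n m - canonicalProfile lam α n k) ≤ 2 * α := by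
  have hm := m.2
  have hle : (m : ℕ) ≤ k + 2 := by
    by_contra! hlt
    by_cases hi : (i : ℕ) = k + 1
    · exact h ⟨k + 2, by omega⟩ (fun hh => by rw [← hh] at hi; simp at hi)
        (Fin.lt_def.2 (by simp)) (Fin.lt_def.2 hlt)
    · exact h ⟨k + 1, by omega⟩ (fun hh => hi (by rw [← hh]))
        (Fin.lt_def.2 (by simp)) (Fin.lt_def.2 (by simp only; omega))
  rw [mul_sub, mul_canonicalProfile hlam, mul_canonicalProfile hlam]
  have : ((m : ℕ) : ℝ) ≤ (k : ℕ) + 2 := by exact_mod_cast hle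
  nlinarith

/-- A peripheral server therefore earns at least as much as an inner one, and `2 * innerShare α`
bounds every equilibrium payoff from below. -/
theorem inner_le_peripheral (hα : 0 ≤ α) : innerShare α ≤ endShare (endGap α) := by
  simp only [innerShare, endShare, exp_neg_endGap hα]
  linarith [Real.exp_pos (-α)]

theorem share_first_canonicalProfile (hlam : 0 < lam) (hα : 0 < α) (hn : 2 ≤ n) :
    share lam (others (canonicalProfile lam α n) ⟨0, by omega⟩)
      (canonicalProfile lam α n ⟨0, by omega⟩) = endShare (endGap α) + innerShare α := by
  rw [(share_first (canonicalProfile_strictMono hlam hα) lam hn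
    (canonicalProfile_strictMono hlam hα (by simp))).2, mul_sub, mul_canonicalProfile hlam,
    mul_canonicalProfile hlam]
  simp

theorem share_last_canonicalProfile (hlam : 0 < lam) (hα : 0 < α) (hn : 2 ≤ n)
    (ht : threshold α n = lam) :
    share lam (others (canonicalProfile lam α n) ⟨n - 1, by omega⟩)
      (canonicalProfile lam α n ⟨n - 1, by omega⟩) = endShare (endGap α) + innerShare α := by
  rw [(share_last (canonicalProfile_strictMono hlam hα) lam hn
    (canonicalProfile_strictMono hlam hα (Fin.lt_def.2 (by simp only; omega)))).2,
    mul_one_sub_canonicalProfile hlam (by omega) ht, mul_sub, mul_canonicalProfile hlam,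
    mul_canonicalProfile hlam]
  have hcast : ((n - 1 : ℕ) : ℝ) = (n - 2 : ℕ) + 1 := by
    rw [show n - 1 = n - 2 + 1 by omega]; push_cast; rfl
  simp only [hcast]
  rw [add_comm]
  congr 2
  ring

theorem le_share_canonicalProfile (hlam : 0 < lam) (hα : 0 < α) (hn : 2 ≤ n)
    (ht : threshold α n = lam) (i : Fin n) : 2 * innerShare α ≤
      share lam (others (canonicalProfile lam α n) i) (canonicalProfile lam α n i) := by
  have hper := inner_le_peripheral hα.le
  obtain ⟨k, hk⟩ := i
  rcases Nat.eq_zero_or_pos k with rfl | hk0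
  · rw [share_first_canonicalProfile hlam hα hn]; linarith
  by_cases hkn : k = n - 1
  · subst hkn
    rw [share_last_canonicalProfile hlam hα hn ht]; linarith
  obtain ⟨k, rfl⟩ : ∃ l, k = l + 1 := ⟨k - 1, by omega⟩
  have hmono := canonicalProfile_strictMono (n := n) hlam hα
  rw [(share_inner hmono lam (k := k) (by omega) (hmono (Fin.lt_def.2 (by simp)))
    (hmono (Fin.lt_def.2 (by simp)))).2]
  simp only [mul_sub, mul_canonicalProfile hlam]
  push_cast
  rw [two_mul]
  refine le_of_eq ?_
  congr 2 <;> ring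

/-- The left end gap left by the competitors of `i` offers no profitable deviation. -/
theorem left_end_deviation_le (hlam : 0 < lam) (hα : 0 < α) (hn : 2 ≤ n)
    (ht : threshold α n = lam)
    (hdev : ∀ t ≤ endGap α, endShare t + innerShare (endGap α - t) ≤ 2 * innerShare α)
    (i : Fin n) {y : ℝ} (hy : ∀ z ∈ others (canonicalProfile lam α n) i, y ≤ z) :
    ∃ q ∈ others (canonicalProfile lam α n) i, (∀ z ∈ others (canonicalProfile lam α n) i, q ≤ z) ∧
      endShare (lam * y) + innerShare (lam * (q - y)) ≤
        share lam (others (canonicalProfile lam α n) i) (canonicalProfile lam α n i) := by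
  have hmono := canonicalProfile_strictMono (n := n) hlam hα
  -- The first server already sits at the balanced, hence optimal, point of the gap before server
  -- `1`. For any other `i` the gap has size `endGap α`, and `hdev` applies.
  by_cases hi : i = ⟨0, by omega⟩
  · subst hi
    have hmem : canonicalProfile lam α n ⟨1, by omega⟩ ∈
        others (canonicalProfile lam α n) ⟨0, by omega⟩ := mem_others_of_ne (by simp)
    refine ⟨_, hmem, fun z hz => ?_, ?_⟩
    · obtain ⟨j, hj, rfl⟩ := mem_others.1 hz
      have hj' : (j : ℕ) ≠ 0 := fun h => hj (Fin.ext h)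
      exact hmono.monotone (Fin.mk_le_of_le_val (by omega))
    · rw [share_first_canonicalProfile hlam hα hn]
      exact endShare_add_innerShare_le (mul_nonneg hlam.le (sub_nonneg.2 (hy _ hmem))) hα.le
        (by rw [mul_sub, mul_canonicalProfile hlam]; push_cast; ring) (exp_neg_endGap hα.le)
  · have hmem : canonicalProfile lam α n ⟨0, by omega⟩ ∈
        others (canonicalProfile lam α n) i := mem_others_of_ne (Ne.symm hi)
    refine ⟨_, hmem, fun z hz => ?_, ?_⟩
    · obtain ⟨j, hj, rfl⟩ := mem_others.1 hz
      exact hmono.monotone (Fin.mk_le_of_le_val (by omega))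
    · have hz : lam * canonicalProfile lam α n ⟨0, by omega⟩ = endGap α := by
        rw [mul_canonicalProfile hlam]; simp
      have h1 := hdev (lam * y) (hz ▸ mul_le_mul_of_nonneg_left (hy _ hmem) hlam.le)
      rw [← hz, ← mul_sub] at h1
      exact h1.trans (le_share_canonicalProfile hlam hα hn ht i)

/-- The right end gap left by the competitors of `i` offers no profitable deviation. -/
theorem right_end_deviation_le (hlam : 0 < lam) (hα : 0 < α) (hn : 2 ≤ n)
    (ht : threshold α n = lam)
    (hdev : ∀ t ≤ endGap α, endShare t + innerShare (endGap α - t) ≤ 2 * innerShare α)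
    (i : Fin n) {y : ℝ} (hy : ∀ z ∈ others (canonicalProfile lam α n) i, z ≤ y) :
    ∃ q ∈ others (canonicalProfile lam α n) i, (∀ z ∈ others (canonicalProfile lam α n) i, z ≤ q) ∧
      endShare (lam * (1 - y)) + innerShare (lam * (y - q)) ≤
        share lam (others (canonicalProfile lam α n) i) (canonicalProfile lam α n i) := by
  have hmono := canonicalProfile_strictMono (n := n) hlam hα
  have hz := mul_one_sub_canonicalProfile (α := α) (n := n) hlam (by omega) ht
  by_cases hi : i = ⟨n - 1, by omega⟩
  · subst hi
    have hmem : canonicalProfile lam α n ⟨n - 2, by omega⟩ ∈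
        others (canonicalProfile lam α n) ⟨n - 1, by omega⟩ :=
      mem_others_of_ne fun h => by simp at h; omega
    refine ⟨_, hmem, fun z hz => ?_, ?_⟩
    · obtain ⟨j, hj, rfl⟩ := mem_others.1 hz
      have hj' : (j : ℕ) ≠ n - 1 := fun h => hj (Fin.ext h)
      have hj2 := j.2
      exact hmono.monotone (Fin.le_def.2 (by simp only; omega))
    · rw [share_last_canonicalProfile hlam hα hn ht]
      refine endShare_add_innerShare_le (mul_nonneg hlam.le (sub_nonneg.2 (hy _ hmem))) hα.le
        ?_ (exp_neg_endGap hα.le)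
      rw [← hz]
      simp only [mul_sub, mul_canonicalProfile hlam]
      rw [show n - 1 = n - 2 + 1 by omega]
      push_cast; ring
  · have hmem : canonicalProfile lam α n ⟨n - 1, by omega⟩ ∈
        others (canonicalProfile lam α n) i := mem_others_of_ne (Ne.symm hi)
    refine ⟨_, hmem, fun z hz => ?_, ?_⟩
    · obtain ⟨j, hj, rfl⟩ := mem_others.1 hz
      have hj2 := j.2
      exact hmono.monotone (Fin.le_def.2 (by simp only; omega))
    · have h1 := hdev (lam * (1 - y))
        (hz ▸ mul_le_mul_of_nonneg_left (by linarith [hy _ hmem]) hlam.le)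
      have h2 : lam * (y - canonicalProfile lam α n ⟨n - 1, by omega⟩) =
          endGap α - lam * (1 - y) := by rw [← hz]; ring
      rw [← h2] at h1
      exact h1.trans (le_share_canonicalProfile hlam hα hn ht i)

/-- Vacant points between two competitors lie in gaps of size at most `2 * α`, where concavity caps
the share at `2 * innerShare α`; points beyond all competitors are covered by the two end-gap
lemmas. At an occupied point each side is worth at most `v`, and the sum is divided by at least two.
-/
theorem isShareEquilibrium_canonicalProfile (hlam : 0 < lam) (hα : 0 < α) (hn : 2 ≤ n)
    (ht : threshold α n = lam)
    (hdev : ∀ t ≤ endGap α, endShare t + innerShare (endGap α - t) ≤ 2 * innerShare α) :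
    IsShareEquilibrium lam (canonicalProfile lam α n) := by
  have hmono := canonicalProfile_strictMono (n := n) hlam hα
  have hmem := canonicalProfile_mem (n := n) hlam hα ht
  refine ⟨hmem, fun i y hy => ?_⟩
  have hself : canonicalProfile lam α n i ∉ others (canonicalProfile lam α n) i := fun h => by
    obtain ⟨j, hj, hj2⟩ := mem_others.1 h
    exact hj (hmono.injective hj2)
  rw [rivalsAt_eq_zero hself, Nat.cast_zero, zero_add, div_one]
  have hv := le_share_canonicalProfile hlam hα hn ht i
  set e := canonicalProfile lam α n with he
  set v := share lam (others e i) (e i) with hvdef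
  have hgap : ∀ {k m : Fin n}, (∀ p, p ≠ i → k < p → ¬ p < m) → lam * (e m - e k) ≤ 2 * α :=
    canonicalProfile_gap_le hlam hα
  by_cases hyS : y ∈ others e i
  · have h2 : innerShare (2 * α) ≤ v := by
      have := innerShare_add_le (a := 2 * α) (b := 0) (c := α) (by linarith) le_rfl (by linarith)
      rw [innerShare_zero] at this
      linarith
    obtain ⟨q, hq, rfl⟩ := mem_others.1 hyS
    have hL : leftShare lam (others e i) (e q) ≤ v := by
      by_cases h : ∃ z ∈ others e i, z < e q
      · obtain ⟨z, hz, hzy, hmax⟩ := exists_next_left h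
        rw [leftShare_of_next hz hzy hmax]
        obtain ⟨k, hk, rfl⟩ := mem_others.1 hz
        refine (innerShare_le (mul_nonneg hlam.le (by linarith)) (hgap fun p hp h1 h2 => ?_)).trans h2
        exact absurd (hmax _ (mem_others_of_ne hp) (hmono h2)) (not_le.2 (hmono h1))
      · push Not at h
        obtain ⟨z, hz, hzmin, hle⟩ := left_end_deviation_le hlam hα hn ht hdev i h
        rw [leftShare_of_none h]
        have := innerShare_nonneg (mul_nonneg hlam.le (sub_nonneg.2 (h z hz)))
        linarith
    have hR : rightShare lam (others e i) (e q) ≤ v := by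
      by_cases h : ∃ z ∈ others e i, e q < z
      · obtain ⟨z, hz, hzy, hmin⟩ := exists_next_right h
        rw [rightShare_of_next hz hzy hmin]
        obtain ⟨k, hk, rfl⟩ := mem_others.1 hz
        refine (innerShare_le (mul_nonneg hlam.le (by linarith)) (hgap fun p hp h1 h2 => ?_)).trans h2
        exact absurd (hmin _ (mem_others_of_ne hp) (hmono h1)) (not_le.2 (hmono h2))
      · push Not at h
        obtain ⟨z, hz, hzmin, hle⟩ := right_end_deviation_le hlam hα hn ht hdev i h
        rw [rightShare_of_none h]
        have := innerShare_nonneg (mul_nonneg hlam.le (sub_nonneg.2 (h z hz)))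
        linarith
    have hr : (1 : ℝ) ≤ rivalsAt e i (e q) := by exact_mod_cast one_le_rivalsAt hyS
    have hv0 : 0 ≤ v := (mul_nonneg zero_le_two (innerShare_nonneg hα.le)).trans hv
    rw [div_le_iff₀ (by linarith), share]
    have := mul_le_mul_of_nonneg_left hr hv0
    linarith
  · rw [rivalsAt_eq_zero hyS, Nat.cast_zero, zero_add, div_one]
    have hne : ∀ z ∈ others e i, z ≠ y := fun z hz h => hyS (h ▸ hz)
    by_cases hl : ∃ z ∈ others e i, z < y
    · by_cases hr : ∃ z ∈ others e i, y < z
      · obtain ⟨l, hlS, hly, hmax⟩ := exists_next_left hl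
        obtain ⟨r, hrS, hry, hmin⟩ := exists_next_right hr
        rw [share, leftShare_of_next hlS hly hmax, rightShare_of_next hrS hry hmin]
        obtain ⟨k, hk, rfl⟩ := mem_others.1 hlS
        obtain ⟨m, hm, rfl⟩ := mem_others.1 hrS
        refine (innerShare_add_le (mul_nonneg hlam.le (by linarith))
          (mul_nonneg hlam.le (by linarith)) ?_).trans hv
        have := hgap (k := k) (m := m) fun p hp h1 h2 => by
          rcases lt_or_gt_of_ne (hne _ (mem_others_of_ne hp)) with h | h
          · exact absurd (hmax _ (mem_others_of_ne hp) h) (not_le.2 (hmono h1))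
          · exact absurd (hmin _ (mem_others_of_ne hp) h) (not_le.2 (hmono h2))
        linarith
      · push Not at hr
        obtain ⟨q, hq, hqmax, hle⟩ := right_end_deviation_le hlam hα hn ht hdev i hr
        rw [share, rightShare_of_none hr,
          leftShare_of_next hq (lt_of_le_of_ne (hr q hq) (hne q hq)) fun z hz _ => hqmax z hz]
        linarith
    · push Not at hl
      obtain ⟨q, hq, hqmin, hle⟩ := left_end_deviation_le hlam hα hn ht hdev i hl
      rw [share, leftShare_of_none hl,
        rightShare_of_next hq (lt_of_le_of_ne (hl q hq) (hne q hq).symm) fun z hz _ => hqmin z hz]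
      exact hle

end canonical

/-- The advantage vanishes at both pairs and is strictly increasing for `α ≤ 1`, so the two `α`
agree; then `β` is determined by the strictly decreasing `exp (-2 * β) * (1 + β)`. -/
theorem pair_unique {α₁ β₁ α₂ β₂ : ℝ} (hα₁ : 0 < α₁) (hα₁' : α₁ < 1) (hβ₁ : 0 ≤ β₁)
    (hα₂ : 0 < α₂) (hα₂' : α₂ < 1) (hβ₂ : 0 ≤ β₂)
    (h₁ : Real.exp (-α₁) * (1 + α₁) = Real.exp (-2 * β₁) * (1 + β₁))
    (h₁' : Real.exp (-α₁) * (1 + α₁ / 2) = Real.exp (-β₁) * (3 / 4 + β₁ / 2))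
    (h₂ : Real.exp (-α₂) * (1 + α₂) = Real.exp (-2 * β₂) * (1 + β₂))
    (h₂' : Real.exp (-α₂) * (1 + α₂ / 2) = Real.exp (-β₂) * (3 / 4 + β₂ / 2)) :
    α₁ = α₂ ∧ β₁ = β₂ := by
  have hα : α₁ = α₂ := by
    rcases lt_trichotomy α₁ α₂ with h | h | h
    · linarith [advantage_lt hα₁.le h hα₂'.le hβ₁ hβ₂ h₁ h₂]
    · exact h
    · linarith [advantage_lt hα₂.le h hα₁'.le hβ₂ hβ₁ h₂ h₁]
  subst hα
  refine ⟨rfl, ?_⟩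
  rcases lt_trichotomy β₁ β₂ with h | h | h
  · linarith [exp_neg_two_mul_mul_one_add_lt hβ₁ h]
  · exact h
  · linarith [exp_neg_two_mul_mul_one_add_lt hβ₂ h]

end FPH

end

theorem theorem3 :
    ∃ α₀ β₀ : ℝ, 0 < α₀ ∧
      {p : ℝ × ℝ | 0 < p.1 ∧ p.1 < 1 ∧ 0 ≤ p.2 ∧
        Real.exp (-p.1) * (1 + p.1) = Real.exp (-2 * p.2) * (1 + p.2) ∧
        Real.exp (-p.1) * (1 + p.1 / 2) = Real.exp (-p.2) * (3 / 4 + p.2 / 2)} = {(α₀, β₀)} ∧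
      |α₀ - 0.58813| < 5 / 10 ^ 6 ∧
      |(α₀ - 2 * Real.log ((1 + α₀) / 2)) - 1.04931| < 5 / 10 ^ 6 ∧
      ∀ n : ℕ, 3 ≤ n → ∀ lam : ℝ, 0 < lam →
        ∀ {Ω : Type*} [MeasurableSpace Ω] (P : MeasureTheory.Measure Ω)
          [MeasureTheory.IsProbabilityMeasure P] (F : Ω → Finset ℝ),
          FPH.IsPoissonFaults P F lam →
          ((∃ x : Fin n → ℝ, FPH.IsNashEquilibrium P F x) ↔ FPH.threshold α₀ n ≤ lam) := by
  obtain ⟨α₀, β₀, hlo, hhi, hβ₀, h₁, h₂⟩ := FPH.exists_alpha_beta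
  have hpos : 0 < α₀ := lt_trans (by norm_num) hlo
  have hlt : α₀ < 1 := hhi.trans (by norm_num)
  refine ⟨α₀, β₀, hpos, ?_, ?_, FPH.log_constant_bounds hlo hhi, ?_⟩
  · ext ⟨α, β⟩
    constructor
    · rintro ⟨h1, h2, h3, h4, h5⟩
      obtain ⟨rfl, rfl⟩ := FPH.pair_unique h1 h2 h3 hpos hlt hβ₀ h4 h5 h₁ h₂
      rfl
    · intro h
      obtain ⟨rfl, rfl⟩ := Prod.mk.inj (Set.mem_singleton_iff.1 h)
      exact ⟨hpos, hlt, hβ₀, h₁, h₂⟩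
  · rw [abs_lt]
    constructor <;> norm_num at * <;> linarith
  · intro n hn lam hlam Ω _ P _ F hF
    constructor
    · rintro ⟨x, hx⟩
      have hx' : FPH.IsShareEquilibrium lam x := (FPH.isNashEquilibrium_iff hlam hF).1 hx
      obtain ⟨e, he, h01, hnash⟩ := hx'.exists_strictMono hlam hn
      exact FPH.threshold_le_of_equilibrium hlt hβ₀ h₁ h₂ hpos hlam hn he h01 hnash
    · intro hthr
      -- The inner gap `α ≥ α₀` is chosen so that the canonical profile exactly fills the line of
      -- rescaled length `lam`.
      obtain ⟨α, hα, ht⟩ := FPH.exists_threshold_eq (by omega) hpos.le hthr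
      exact ⟨_, (FPH.isNashEquilibrium_iff hlam hF).2
        (FPH.isShareEquilibrium_canonicalProfile hlam (hpos.trans_le hα) (by omega) ht
          fun t h => FPH.deviation_to_end_le hpos.le hβ₀ h₁ h₂ hα h)⟩
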